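/- Let $p<p'$ be coprime positive integers with $p'\ge 3$, and let $(r_0,s_0)$ be the smallest pair of non-negative integers with $|ps_0-p'r_0|=1$ (the smallest in both coordinates). Let $L\ge 0$ be an even integer. **Finitised character.** For integers $a,b,c$ with $1\le a,b,c\le p'-1$ and $c=b\pm1$, let $\mathcal P^{p,p'}_{a,b,c}(L)$ be the set of integer sequences $h=(h_0,\dots,h_L)$ with $1\le h_i\le p'-1$, $h_{i+1}=h_i\pm1$, $h_0=a$, $h_L=b$; put $h_{L+1}=c$. Write $\hat r(h)=\lfloor h(p'-p)/p'\rfloor$ and let $wt(h)=\sum_{i=1}^L i\,\kappa(h_{i-1},h_i,h_{i+1})$, where $\kappa(h\mp1,h,h\pm1)=\tfrac12$, $\kappa(h,h+1,h)=-\hat r(h)$, $\kappa(h,h-1,h)=\hat r(h)$. The finitised character is $$\chi^{p,p'}_{a,b,c}(L)=q^{-\hat r(c)(a-b\pm L)/2-(a-b)(a-c)/4}\sum_{h\in\mathcal P^{p,p'}_{a,b,c}(L)}q^{wt(h)},$$ where the sign $\pm$ is that of $c=b\pm1$. **Cartan matrix.** Let $p'/p=c_0+\cfrac{1}{c_1+\cfrac{1}{\cdots+\cfrac1{c_n}}}$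 be the continued fraction with $c_0\ge 0$, $c_i\ge1$ for $0<i<n$ and $c_n\ge2$. Put $t_\mu=-1+\sum_{i=0}^{\mu-1}c_i$ for $0\le\mu\le n$ and $t=-2+\sum_{i=0}^{n}c_i$. Let $C=(C_{ij})_{0\le i,j\le t-1}$ be the tridiagonal matrix whose row $j$ has entries $C_{j,j-1}=-1$, $C_{j,j}=1$, $C_{j,j+1}=1$ if $j=t_\mu$ for some $\mu\in\{1,\dots,n\}$, and $C_{j,j-1}=-1$, $C_{j,j}=2$, $C_{j,j+1}=-1$ otherwise (entries with an index out of range are dropped). **Gaussian polynomials.** For integers $A,B$ let $\left[{A\atop B}\right]_q=\dfrac{\prod_{i=1}^{A}(1-q^i)}{\prod_{i=1}^{B}(1-q^i)\prod_{i=1}^{A-B}(1-q^i)}$ if $0\le B\le A$, and $0$ otherwise. **Theorem.** For even $L\ge 0$, $$\chi^{p,p'}_{s_0,s_0,s_0+1}(L)=\sum_{m}q^{\frac14 m^TCm-\frac14L^2}\prod_{j=1}^{t-1}\left[{m_j-\frac12(Cm)_j\atop m_j}\right]_q,$$ where the sum runs over all vectors $m=(m_0,m_1,\dots,m_{t-1})$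 with $m_0=L$ and with $m_1,\dots,m_{t-1}$ even non-negative integers; only finitely many terms of the sum are non-zero. -/

import Mathlib

open scoped Matrix

noncomputable section

namespace FB

/-- The field in which the identity lives: Hahn series in `q` over `ℚ` with rational exponents
(it contains all polynomials in fractional powers of `q` and `q⁻¹`). -/
abbrev QField : Type := HahnSeries ℚ ℚ

/-- The monomial `q ^ e`, for a rational exponent `e`. -/
def qpow (e : ℚ) : QField := HahnSeries.single e 1

/-- The product `∏_{i=1}^{k} (1 - q ^ i)`. -/
def qPoch (k : ℕ) : QField := ∏ i ∈ Finset.Icc 1 k, (1 - qpow (i : ℚ))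

/-- The Gaussian polynomial `[A choose B]_q`, equal to zero unless `0 ≤ B ≤ A`. -/
def gaussian (A B : ℤ) : QField :=
  if 0 ≤ B ∧ B ≤ A then qPoch A.toNat / (qPoch B.toNat * qPoch (A - B).toNat) else 0

/-! ### Paths and their weights -/

/-- The paths `h_0, …, h_L` of length `L` from height `a` to height `b`: all heights lie in
`{1, …, p' - 1}` and consecutive heights differ by one. -/
def paths (p' : ℕ) (a b : ℤ) (L : ℕ) : Finset (Fin (L + 1) → ℤ) :=
  (Fintype.piFinset fun _ => Finset.Icc (1 : ℤ) ((p' : ℤ) - 1)).filter fun h =>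
    h 0 = a ∧ h (Fin.last L) = b ∧
      ∀ i : Fin L, h i.succ = h i.castSucc + 1 ∨ h i.succ = h i.castSucc - 1

/-- The heights of a path, continued by `h_{L+1} = c`. -/
def height {L : ℕ} (h : Fin (L + 1) → ℤ) (c : ℤ) (i : ℕ) : ℤ :=
  if hi : i < L + 1 then h ⟨i, hi⟩ else c

/-- `⌊h (p' - p) / p'⌋`. -/
def rHat (p p' : ℕ) (h : ℤ) : ℤ := ⌊((h : ℚ) * ((p' : ℚ) - (p : ℚ))) / (p' : ℚ)⌋

/-- The Forrester–Baxter local weight of a vertex with heights `(x, y, z)`: a peak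
`(x, x + 1, x)`, a trough `(x, x - 1, x)`, or a straight vertex. -/
def localWeight (p p' : ℕ) (x y z : ℤ) : ℚ :=
  if x = z then
    if y = x + 1 then -(rHat p p' x : ℚ) else (rHat p p' x : ℚ)
  else 1 / 2

/-- The Forrester–Baxter weight of a path, where `h_{L+1} = c`. -/
def weight (p p' : ℕ) (c : ℤ) {L : ℕ} (h : Fin (L + 1) → ℤ) : ℚ :=
  ∑ i ∈ Finset.Icc 1 L,
    (i : ℚ) * localWeight p p' (height h c (i - 1)) (height h c i) (height h c (i + 1))

/-- The path generating function `φ^{p,p'}_{a,b,c}(L)`. -/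
def phi (p p' : ℕ) (a b c : ℤ) (L : ℕ) : QField :=
  ∑ h ∈ paths p' a b L, qpow (weight p p' c h)

/-- The finitised character `χ^{p,p'}_{a,b,c}(L)`, where `c = b ± 1`: the normalised generating
function `q ^ (-r̂(c) (a - b ± L) / 2 - (a - b) (a - c) / 4) φ^{p,p'}_{a,b,c}(L)`, with `r̂(c)` the
number `rHat p p' c` and with the sign `±` given by `c - b`. -/
def chi (p p' : ℕ) (a b c : ℤ) (L : ℕ) : QField :=
  qpow (-(rHat p p' c : ℚ) * ((a : ℚ) - b + ((c : ℚ) - b) * L) / 2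
      - ((a : ℚ) - b) * ((a : ℚ) - c) / 4) * phi p p' a b c L

/-! ### Continued fractions and the generalised Cartan matrix -/

/-- `(r₀, s₀)` is the smallest pair of non-negative integers with `|p s₀ - p' r₀| = 1`. -/
def IsMinimalSolution (p p' r₀ s₀ : ℕ) : Prop :=
  |(p : ℤ) * s₀ - (p' : ℤ) * r₀| = 1 ∧
    ∀ r s : ℕ, |(p : ℤ) * s - (p' : ℤ) * r| = 1 → r₀ ≤ r ∧ s₀ ≤ s

/-- The value `c_0 + 1 / (c_1 + 1 / (⋯ + 1 / c_n))`. -/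
def cfValue : List ℕ → ℚ
  | [] => 0
  | [a] => a
  | a :: b :: l => a + 1 / cfValue (b :: l)

/-- The list `l = [c_0, …, c_n]` is the continued fraction of `x`, normalised by `c_i ≥ 1` for
`0 < i < n` and `c_n ≥ 2`. -/
structure IsContFrac (l : List ℕ) (x : ℚ) : Prop where
  ne_nil : l ≠ []
  one_le : ∀ i (hi : i < l.length), 0 < i → 1 ≤ l[i]
  two_le_last : 2 ≤ l.getLast ne_nil
  value_eq : cfValue l = x

/-- `t_μ = -1 - δ_{μ,n+1} + ∑_{i<μ} c_i`, for `c = [c_0, …, c_n]` and `0 ≤ μ ≤ n + 1`. -/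
def zoneEnd (c : List ℕ) (μ : ℕ) : ℤ :=
  -1 - (if μ = c.length then 1 else 0) + ((c.take μ).sum : ℤ)

/-- The rank `t = t_{n+1} = c_0 + ⋯ + c_n - 2`. -/
def rank (c : List ℕ) : ℕ := (zoneEnd c c.length).toNat

/-- `j = t_μ` for some `μ = 1, …, n`, where `c = [c_0, …, c_n]`. -/
def IsZoneEnd (c : List ℕ) (j : ℕ) : Prop :=
  ∃ μ : ℕ, 1 ≤ μ ∧ μ < c.length ∧ (j : ℤ) = zoneEnd c μ

open Classical in
/-- The generalised Cartan matrix, with rows and columns indexed by `0, …, t - 1`. -/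
def cartan (c : List ℕ) : Matrix (Fin (rank c)) (Fin (rank c)) ℤ :=
  Matrix.of fun i j =>
    if (j : ℕ) + 1 = i then -1
    else if j = i then (if IsZoneEnd c i then 1 else 2)
    else if (j : ℕ) = i + 1 then (if IsZoneEnd c i then 1 else -1)
    else 0

/-- The vectors `m = (L, m_1, …, m_{t-1})` with `m_1, …, m_{t-1}` even and non-negative. -/
def mVectors (c : List ℕ) (L : ℕ) : Set (Fin (rank c) → ℤ) :=
  {m | ∀ j : Fin (rank c), ((j : ℕ) = 0 → m j = L) ∧ (0 < (j : ℕ) → Even (m j) ∧ 0 ≤ m j)}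

/-- The summand `q ^ ((mᵀ C m - L²) / 4) ∏_{j=1}^{t-1} [m_j - (C m)_j / 2 choose m_j]_q`
(the integer division by `2` is exact for `m ∈ mVectors c L` with `L` even). -/
def summand (c : List ℕ) (L : ℕ) (m : Fin (rank c) → ℤ) : QField :=
  qpow (((m ⬝ᵥ cartan c *ᵥ m : ℤ) : ℚ) / 4 - (L : ℚ) ^ 2 / 4) *
    ∏ j ∈ Finset.univ.filter (fun j : Fin (rank c) => 0 < (j : ℕ)),
      gaussian (m j - (cartan c *ᵥ m) j / 2) (m j)

end FB

end

noncomputable section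

namespace FB

/-! Both sides equal a bosonic expression, an alternating sum over `k : ℤ` of Gaussian polynomials.
On the path side, deleting the last step gives a recurrence for the characters. The normalising
power in `chi` turns its coefficients into those of the two q-Pascal rules, and the walls at heights
0 and p' become zeros of the alternating sum under reflection. This gives `chi_eq_bosonic`.

On the fermionic side, the bosonic sum has a two-variable refinement `burgePoly`. The Burge
transform, which is q-Pfaff–Saalschütz applied for each `k`, expresses the polynomial of (p, p')
through those of (p, p' - p) (`burgePoly_step`), while `burgePoly_swap` exchanges p and p'. Together
they run the subtractive Euclidean algorithm on p'/p, carrying (r, s) along, down to (1, 2), where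
the polynomial is a Kronecker delta. Each subtraction is one row of the Cartan matrix, and at a zone
end it is followed by a swap. Row 0 comes from the limit M → ∞ of the transform, which is
q-Vandermonde, so it carries no Gaussian factor (`bosonic_eq_fermi`).

Unrolling gives the nested sum `fermi`. With m_j = 2 κ_j the quadratic form of the Cartan matrix
telescopes into a sum of squares, one per row, and the terms of the nested sum are the required
summands (`summand_eq`, `finsum_summand`). -/

/-! ### Gaussian polynomials and the q-Pascal rules. -/

theorem qpow_zero : qpow 0 = 1 := rfl

theorem qpow_add (x y : ℚ) : qpow (x + y) = qpow x * qpow y := by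
  simp [qpow, HahnSeries.single_mul_single]

theorem qpow_injective : Function.Injective qpow := fun x y h => by
  by_contra hxy
  have := congrArg (fun f : QField => f.coeff x) h
  simp [qpow, HahnSeries.coeff_single_of_ne hxy] at this

theorem one_sub_qpow_ne_zero {x : ℚ} (hx : x ≠ 0) : (1 : QField) - qpow x ≠ 0 := fun h =>
  hx (qpow_injective (by rw [qpow_zero]; exact (sub_eq_zero.mp h).symm))

theorem qPoch_zero : qPoch 0 = 1 := by simp [qPoch]

theorem qPoch_succ (k : ℕ) : qPoch (k + 1) = qPoch k * (1 - qpow ((k : ℚ) + 1)) := by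
  rw [qPoch, Finset.prod_Icc_succ_top (by omega)]
  simp [qPoch]

theorem qPoch_ne_zero (k : ℕ) : qPoch k ≠ 0 :=
  Finset.prod_ne_zero_iff.mpr fun i hi =>
    one_sub_qpow_ne_zero (Nat.cast_ne_zero.mpr (by have := (Finset.mem_Icc.mp hi).1; omega))

theorem gaussian_of_neg {A B : ℤ} (h : B < 0) : gaussian A B = 0 := if_neg (by omega)

theorem gaussian_of_lt {A B : ℤ} (h : A < B) : gaussian A B = 0 := if_neg (by omega)

theorem gaussian_ne_zero_bounds {A B : ℤ} (h : gaussian A B ≠ 0) : 0 ≤ B ∧ B ≤ A :=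
  not_imp_comm.mp (fun h' => if_neg h') h

theorem gaussian_add_natCast (m n : ℕ) :
    gaussian ((m : ℤ) + n) n = qPoch (m + n) / (qPoch n * qPoch m) := by
  rw [gaussian, if_pos (by omega)]
  congr 2
  simp

theorem gaussian_symm (A B : ℤ) : gaussian A (A - B) = gaussian A B := by
  unfold gaussian
  by_cases h : 0 ≤ B ∧ B ≤ A
  · rw [if_pos h, if_pos (by omega), mul_comm, sub_sub_cancel]
  · rw [if_neg h, if_neg (by omega)]

theorem gaussian_zero_right {A : ℤ} (h : 0 ≤ A) : gaussian A 0 = 1 := by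
  lift A to ℕ using h
  have := gaussian_add_natCast A 0
  simpa [qPoch_zero, qPoch_ne_zero] using this

theorem gaussian_zero_left (B : ℤ) : gaussian 0 B = if B = 0 then 1 else 0 := by
  split_ifs with h
  · rw [h, gaussian_zero_right le_rfl]
  · exact if_neg (by omega)

theorem gaussian_self {A : ℤ} (h : 0 ≤ A) : gaussian A A = 1 := by
  rw [← gaussian_symm, sub_self, gaussian_zero_right h]

/-- The `q`-Pascal rule. -/
theorem gaussian_pascal {A B : ℤ} (h : A ≠ 0 ∨ B ≠ 0) :
    gaussian A B = gaussian (A - 1) (B - 1) + qpow (B : ℚ) * gaussian (A - 1) B := by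
  -- The rule fails only at A = B = 0, where the left side is 1 and both terms on the right vanish.
  rcases lt_trichotomy B 0 with hB | rfl | hB
  · simp [gaussian_of_neg hB, gaussian_of_neg (show B - 1 < 0 by omega)]
  · rw [gaussian_of_neg (show (0 : ℤ) - 1 < 0 by omega)]
    rcases lt_or_gt_of_ne (h.resolve_right (by simp)) with hA | hA
    · simp [gaussian_of_lt hA, gaussian_of_lt (show A - 1 < 0 by omega)]
    · simp [gaussian_zero_right hA.le, gaussian_zero_right (show 0 ≤ A - 1 by omega), qpow_zero]
  rcases lt_trichotomy A B with hA | rfl | hA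
  · simp [gaussian_of_lt hA, gaussian_of_lt (show A - 1 < B by omega),
      gaussian_of_lt (show A - 1 < B - 1 by omega)]
  · simp [gaussian_self hB.le, gaussian_self (show 0 ≤ A - 1 by omega),
      gaussian_of_lt (show A - 1 < A by omega)]
  · obtain ⟨n, rfl⟩ : ∃ n : ℕ, B = (n + 1 : ℕ) := ⟨(B - 1).toNat, by omega⟩
    obtain ⟨m, rfl⟩ : ∃ m : ℕ, A = ((m + 1 : ℕ) : ℤ) + (n + 1 : ℕ) :=
      ⟨(A - (n + 1 : ℕ) - 1).toNat, by omega⟩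
    have e1 : (((m + 1 : ℕ) : ℤ) + (n + 1 : ℕ) - 1) = ((m + 1 : ℕ) : ℤ) + (n : ℕ) := by
      push_cast; ring
    have e2 : (((m + 1 : ℕ) : ℤ) + (n + 1 : ℕ) - 1) = (m : ℤ) + (n + 1 : ℕ) := by
      push_cast; ring
    have e3 : (((n + 1 : ℕ) : ℤ) - 1) = (n : ℤ) := by push_cast; ring
    rw [gaussian_add_natCast, e3]
    nth_rewrite 1 [e1]
    rw [e2, gaussian_add_natCast, gaussian_add_natCast]
    have h1 : m + 1 + (n + 1) = (m + n + 1) + 1 := by ring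
    have h2 : m + 1 + n = m + n + 1 := by ring
    have h3 : m + (n + 1) = m + n + 1 := by ring
    rw [h1, h2, h3, qPoch_succ (m + n + 1), qPoch_succ n, qPoch_succ m]
    have p1 := qPoch_ne_zero n
    have p2 := qPoch_ne_zero m
    have q1 : (1 : QField) - qpow ((n : ℚ) + 1) ≠ 0 := one_sub_qpow_ne_zero (by positivity)
    have q2 : (1 : QField) - qpow ((m : ℚ) + 1) ≠ 0 := one_sub_qpow_ne_zero (by positivity)
    have hq : qpow (((m + n + 1 : ℕ) : ℚ) + 1) = qpow ((m : ℚ) + 1) * qpow ((n : ℚ) + 1) := by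
      rw [← qpow_add]; push_cast; ring_nf
    have hq' : qpow (((((n + 1 : ℕ)) : ℤ) : ℚ)) = qpow ((n : ℚ) + 1) := by push_cast; rfl
    rw [hq, hq']
    field_simp
    ring

theorem gaussian_pascal' {A B : ℤ} (h : A ≠ 0 ∨ B ≠ 0) :
    gaussian A B = qpow ((A : ℚ) - B) * gaussian (A - 1) (B - 1) + gaussian (A - 1) B := by
  rw [← gaussian_symm, gaussian_pascal (by omega), ← gaussian_symm (A - 1) B,
    ← gaussian_symm (A - 1) (B - 1)]
  rw [show A - 1 - (B - 1) = A - B by ring, show A - 1 - B = A - B - 1 by ring]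
  push_cast
  ring

/-! ### The q-Vandermonde and q-Pfaff–Saalschütz summations. -/

/-- A finite-support criterion for sums over the integers. -/
theorem support_finite_of_bounds {f : ℤ → QField} (l u : ℤ) (h : ∀ j, f j ≠ 0 → l ≤ j ∧ j ≤ u) :
    f.HasFiniteSupport :=
  (Set.finite_Icc l u).subset fun j hj => h j hj

/-- Shifting the summation variable of a sum over the integers. -/
theorem finsum_shift (f : ℤ → QField) (d : ℤ) : ∑ᶠ j, f (j + d) = ∑ᶠ j, f j :=
  finsum_comp_equiv (Equiv.addRight d)

/-- The right side depends only on x + y and x + c, so it is unchanged by (x + 1, y, c) ↦ (x, y + 1,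
c + 1). Pascal's rule in x, a shift of `j` and Pascal's rule in y show the same for the left side.
-/
theorem gaussian_vandermonde (x y : ℕ) (c : ℤ) :
    ∑ᶠ j : ℤ, qpow ((j : ℚ) * (j + c)) * gaussian x j * gaussian y (j + c)
      = gaussian (x + y) (x + c) := by
  induction x generalizing y c with
  | zero =>
    rw [finsum_eq_single _ 0]
    · simp [gaussian_zero_left, qpow_zero]
    · intro j hj
      simp [gaussian_zero_left, hj]
  | succ x ih =>
    have hs : ∀ (f g : ℤ → QField), (fun j => f j * gaussian x j * g j).HasFiniteSupport :=
      fun f g => support_finite_of_bounds 0 x fun j hj =>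
        gaussian_ne_zero_bounds (right_ne_zero_of_mul (left_ne_zero_of_mul hj))
    have key := ih (y + 1) (c + 1)
    rw [show (((x + 1 : ℕ) : ℤ) + y) = (x : ℤ) + ((y + 1 : ℕ) : ℤ) by push_cast; ring,
      show (((x + 1 : ℕ) : ℤ) + c) = (x : ℤ) + (c + 1) by push_cast; ring, ← key]
    have hsplit : ∀ j : ℤ, qpow ((j : ℚ) * (j + c)) * gaussian ((x + 1 : ℕ) : ℤ) j
        * gaussian y (j + c) =
        qpow ((j : ℚ) * (j + c)) * gaussian x (j - 1) * gaussian y (j + c) +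
        (qpow ((j : ℚ) * (j + c)) * qpow j) * gaussian x j * gaussian y (j + c) := by
      intro j
      rw [gaussian_pascal (A := ((x + 1 : ℕ) : ℤ)) (Or.inl (by positivity)),
        show ((x + 1 : ℕ) : ℤ) - 1 = x by push_cast; ring]
      ring
    simp_rw [hsplit]
    have hfin : (fun j : ℤ => qpow ((j : ℚ) * (j + c)) * gaussian x (j - 1) *
        gaussian y (j + c)).HasFiniteSupport :=
      support_finite_of_bounds 1 (x + 1) fun j hj => by
        have := gaussian_ne_zero_bounds (right_ne_zero_of_mul (left_ne_zero_of_mul hj))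
        omega
    rw [finsum_add_distrib hfin (hs _ _), ← finsum_shift _ 1,
      ← finsum_add_distrib (by simpa only [add_sub_cancel_right] using hs _ _) (hs _ _)]
    refine finsum_congr fun j => ?_
    rw [gaussian_pascal (A := ((y + 1 : ℕ) : ℤ)) (Or.inl (by positivity)),
      show ((y + 1 : ℕ) : ℤ) - 1 = y by push_cast; ring,
      show j + (c + 1) - 1 = j + c by ring, show j + 1 + c = j + (c + 1) by ring,
      add_sub_cancel_right, ← qpow_add,
      show (((j + 1 : ℤ) : ℚ) * (((j + 1 : ℤ) : ℚ) + c))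
        = (j : ℚ) * (j + (c + 1 : ℤ)) + ((j + (c + 1) : ℤ) : ℚ) by push_cast; ring, qpow_add,
      show (j : ℚ) * (j + c) + j = (j : ℚ) * (j + (c + 1 : ℤ)) by push_cast; ring]
    ring

/-- The `q`-Pfaff–Saalschütz summation. -/
theorem gaussian_saalschuetz (x y : ℕ) (n c : ℤ) :
    ∑ᶠ j : ℤ, qpow ((j : ℚ) * (j + c)) * gaussian x j *
        (gaussian y (j + c) * gaussian (x + y + n - j) (n - j))
      = gaussian (n + c + x) n * gaussian (n + y) (n + c) := by
  induction x generalizing y n c with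
  | zero =>
    rw [finsum_eq_single _ 0]
    · simp only [Int.cast_zero, zero_mul, qpow_zero, Nat.cast_zero, zero_add, sub_zero, add_zero,
        gaussian_zero_right le_rfl, one_mul]
      -- Only `j = 0` survives, and the claim is the trinomial revision identity; outside this range
      -- both sides are zero.
      by_cases h : 0 ≤ n ∧ 0 ≤ c ∧ c ≤ y
      · obtain ⟨hn, hc, hcy⟩ := h
        lift n to ℕ using hn
        lift c to ℕ using hc
        obtain ⟨d, rfl⟩ : ∃ d : ℕ, y = d + c := ⟨y - c, by omega⟩
        rw [show ((d + c : ℕ) : ℤ) = (d : ℤ) + c by push_cast; ring, gaussian_add_natCast,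
          show (d : ℤ) + c + n = ((d + c : ℕ) : ℤ) + n by push_cast; ring, gaussian_add_natCast,
          show (n : ℤ) + c = (c : ℤ) + n by ring, gaussian_add_natCast,
          show (n : ℤ) + (d + c) = (d : ℤ) + ((c + n : ℕ) : ℤ) by push_cast; ring,
          show (c : ℤ) + n = ((c + n : ℕ) : ℤ) by push_cast; ring, gaussian_add_natCast]
        have := qPoch_ne_zero d
        have := qPoch_ne_zero c
        have := qPoch_ne_zero n
        have := qPoch_ne_zero (d + c)
        have := qPoch_ne_zero (c + n)
        rw [add_assoc d c n]
        field_simp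
      · trans (0 : QField)
        · by_contra h'
          have h1 := gaussian_ne_zero_bounds (left_ne_zero_of_mul h')
          have h2 := gaussian_ne_zero_bounds (right_ne_zero_of_mul h')
          omega
        · by_contra h'
          have h1 := gaussian_ne_zero_bounds (left_ne_zero_of_mul (Ne.symm h'))
          have h2 := gaussian_ne_zero_bounds (right_ne_zero_of_mul (Ne.symm h'))
          omega
    · intro j hj
      simp [gaussian_zero_left, hj]
  | succ x ih =>
    have hs : ∀ (f g : ℤ → QField), (fun j => f j * gaussian x j * g j).HasFiniteSupport :=
      fun f g => support_finite_of_bounds 0 x fun j hj =>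
        gaussian_ne_zero_bounds (right_ne_zero_of_mul (left_ne_zero_of_mul hj))
    have key1 := ih (y + 1) (n - 1) (c + 1)
    have key2 := ih y n c
    -- The closed form satisfies the recurrence in x that is then verified for the sum. If n + c <
    -- 0, Pascal's rule may hit its excluded case, but the factor `gaussian (n + y) (n + c)` is then
    -- zero.
    have hR : gaussian (n + c + ((x + 1 : ℕ) : ℤ)) n * gaussian (n + y) (n + c)
        = gaussian (n - 1 + (c + 1) + x) (n - 1) * gaussian (n - 1 + (y + 1 : ℕ)) (n - 1 + (c + 1))
          + qpow n * (gaussian (n + c + x) n * gaussian (n + y) (n + c)) := by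
      rw [show n - 1 + (c + 1) + (x : ℤ) = n + c + x by ring,
        show n - 1 + ((y + 1 : ℕ) : ℤ) = n + y by push_cast; ring,
        show n - 1 + (c + 1) = n + c by ring]
      by_cases h0 : n + c < 0
      · simp [gaussian_of_neg h0]
      · rw [gaussian_pascal (A := n + c + ((x + 1 : ℕ) : ℤ)) (Or.inl (by push_cast; omega)),
          show n + c + ((x + 1 : ℕ) : ℤ) - 1 = n + c + x by push_cast; ring]
        ring
    rw [hR, ← key1, ← key2, mul_finsum' _ _ (by simpa only [mul_assoc] using hs _ _),
      ← finsum_add_distrib (hs _ _)]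
    swap
    · exact (hs (fun j => qpow ((j : ℚ) * (j + c))) _).subset fun j hj => right_ne_zero_of_mul hj
    have hsplit : ∀ j : ℤ, qpow ((j : ℚ) * (j + c)) * gaussian ((x + 1 : ℕ) : ℤ) j
        * (gaussian y (j + c) * gaussian (((x + 1 : ℕ) : ℤ) + y + n - j) (n - j)) =
        qpow ((j : ℚ) * (j + c)) * gaussian x (j - 1) * (gaussian y (j + c) *
          gaussian (((x + 1 : ℕ) : ℤ) + y + n - j) (n - j)) +
        (qpow ((j : ℚ) * (j + c)) * qpow j) * gaussian x j * (gaussian y (j + c) *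
          gaussian (((x + 1 : ℕ) : ℤ) + y + n - j) (n - j)) := by
      intro j
      rw [gaussian_pascal (A := ((x + 1 : ℕ) : ℤ)) (Or.inl (by positivity)),
        show ((x + 1 : ℕ) : ℤ) - 1 = x by push_cast; ring]
      ring
    simp_rw [hsplit]
    have hfin : (fun j : ℤ => qpow ((j : ℚ) * (j + c)) * gaussian x (j - 1) *
        (gaussian y (j + c) *
          gaussian (((x + 1 : ℕ) : ℤ) + y + n - j) (n - j))).HasFiniteSupport :=
      support_finite_of_bounds 1 (x + 1) fun j hj => by
        have := gaussian_ne_zero_bounds (right_ne_zero_of_mul (left_ne_zero_of_mul hj))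
        omega
    rw [finsum_add_distrib hfin (hs _ _), ← finsum_shift _ 1,
      ← finsum_add_distrib (by simpa only [add_sub_cancel_right] using hs _ _) (hs _ _)]
    refine finsum_congr fun j => ?_
    rw [gaussian_pascal (A := ((y + 1 : ℕ) : ℤ)) (Or.inl (by positivity)),
      show ((y + 1 : ℕ) : ℤ) - 1 = y by push_cast; ring,
      show j + (c + 1) - 1 = j + c by ring, show j + 1 + c = j + (c + 1) by ring,
      add_sub_cancel_right, ← qpow_add,
      show (((j + 1 : ℤ) : ℚ) * (((j + 1 : ℤ) : ℚ) + c))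
        = (j : ℚ) * (j + (c + 1 : ℤ)) + ((j + (c + 1) : ℤ) : ℚ) by push_cast; ring, qpow_add,
      show (j : ℚ) * (j + c) + j = (j : ℚ) * (j + (c + 1 : ℤ)) by push_cast; ring,
      gaussian_pascal (A := ((x + 1 : ℕ) : ℤ) + y + n - j) (B := n - j) (by push_cast; omega),
      show ((x + 1 : ℕ) : ℤ) + y + n - (j + 1) = x + y + n - j by push_cast; ring,
      show ((x + 1 : ℕ) : ℤ) + y + n - j - 1 = x + y + n - j by push_cast; ring,
      show (x : ℤ) + ((y + 1 : ℕ) : ℤ) + (n - 1) - j = x + y + n - j by push_cast; ring,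
      show n - (j + 1) = n - j - 1 by ring, show n - 1 - j = n - j - 1 by ring]
    have hq : qpow n * qpow ((j : ℚ) * (j + c))
        = qpow ((j : ℚ) * (j + (c + 1 : ℤ))) * qpow ((n - j : ℤ) : ℚ) := by
      rw [← qpow_add, ← qpow_add]; push_cast; ring_nf
    linear_combination -(gaussian x j * gaussian y (j + c) * gaussian (x + y + n - j) (n - j)) * hq

/-! ### The Burge transform and the two-variable bosonic polynomials. -/

/-- Summing a function on the integers that vanishes off `{0, …, N}`. -/
theorem finsum_int_eq_sum_range {f : ℤ → QField} {N : ℕ} (h : ∀ i, f i ≠ 0 → 0 ≤ i ∧ i ≤ N) :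
    ∑ᶠ i, f i = ∑ i ∈ Finset.range (N + 1), f i := by
  rw [finsum_eq_sum_of_support_subset (s := (Finset.range (N + 1)).map Nat.castEmbedding) f,
    Finset.sum_map]
  · rfl
  · intro i hi
    obtain ⟨h0, hN⟩ := h i hi
    simp only [Finset.coe_map, Set.mem_image, Finset.mem_coe, Finset.mem_range,
      Nat.castEmbedding_apply]
    exact ⟨i.toNat, by omega, by omega⟩

/-- The product of two Gaussian polynomials on which the Burge transform acts. -/
def burgeB (N M a b : ℤ) : QField :=
  gaussian (N + M + a - b) (N + a) * gaussian (N + M - a + b) (N - a)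

theorem burgeB_ne_zero_bounds {N M a b : ℤ} (h : burgeB N M a b ≠ 0) :
    0 ≤ N + a ∧ 0 ≤ N - a ∧ b ≤ M ∧ -b ≤ M := by
  have h1 := gaussian_ne_zero_bounds (left_ne_zero_of_mul h)
  have h2 := gaussian_ne_zero_bounds (right_ne_zero_of_mul h)
  omega

theorem burgeB_swap (N M a b : ℤ) : burgeB N M a b = burgeB M N b a := by
  rw [burgeB, burgeB, ← gaussian_symm (N + M + a - b), ← gaussian_symm (N + M - a + b), mul_comm]
  congr 2 <;> ring

theorem burgeB_sub_natCast (x y : ℕ) {N a b : ℤ} (hx : N + a - b = x) (hy : N - a + b = y)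
    (j : ℤ) : burgeB (N - (j + b)) (j + b) a b = gaussian x j * gaussian y (j + 2 * b) := by
  rw [burgeB, ← gaussian_symm x, ← gaussian_symm y]
  congr 2 <;> linarith

/-- The Burge transform. -/
theorem burge_transform (N : ℕ) (M : ℤ) {a b : ℤ} (hab : 0 ≤ a ∧ 0 ≤ b ∨ a ≤ 0 ∧ b ≤ 0) :
    ∑ i ∈ Finset.range (N + 1), qpow ((i : ℚ) ^ 2) * gaussian (2 * N + M - i) (2 * N) *
        burgeB (N - i) i a b
      = qpow ((b : ℚ) ^ 2) * burgeB N M (a + b) b := by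
  -- If |a - b| > N, both sides vanish: a nonzero left term forces |a| + |b| ≤ N, and a nonzero
  -- right side forces |a + b| ≤ N, where |a + b| ≥ |a - b| because the signs agree.
  by_cases hN : 0 ≤ N + a - b ∧ 0 ≤ N - a + b
  swap
  · trans (0 : QField)
    · refine Finset.sum_eq_zero fun i _ => ?_
      by_contra h
      have := burgeB_ne_zero_bounds (right_ne_zero_of_mul h)
      omega
    · by_contra h
      have := burgeB_ne_zero_bounds (right_ne_zero_of_mul (Ne.symm h))
      omega
  obtain ⟨x, hx⟩ := Int.eq_ofNat_of_zero_le hN.1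
  obtain ⟨y, hy⟩ := Int.eq_ofNat_of_zero_le hN.2
  trans ∑ᶠ i : ℤ, qpow ((i : ℚ) ^ 2) * gaussian (2 * N + M - i) (2 * N) *
        burgeB (N - i) i a b
  · rw [finsum_int_eq_sum_range (N := N)]
    · simp
    · intro i hi
      have := burgeB_ne_zero_bounds (right_ne_zero_of_mul hi)
      omega
  -- With i = j + b the sum is the Saalschütz sum for x = N + a - b, y = N - a + b, n = M - b and c
  -- = 2b.
  rw [← finsum_shift _ b]
  have key := gaussian_saalschuetz x y (M - b) (2 * b)
  have hR : burgeB N M (a + b) b = gaussian (M - b + 2 * b + x) (M - b) *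
      gaussian (M - b + y) (M - b + 2 * b) := by
    rw [burgeB, ← gaussian_symm (M - b + 2 * b + x), ← gaussian_symm (M - b + y)]
    congr 2 <;> linarith
  rw [hR, ← key, mul_finsum']
  · refine finsum_congr fun j => ?_
    rw [burgeB_sub_natCast x y hx hy, ← gaussian_symm (2 * N + M - (j + b : ℤ)) (2 * N),
      show (2 * N + M - (j + b : ℤ) : ℤ) = x + y + (M - b) - j by linarith,
      show (x + y + (M - b) - j - 2 * N : ℤ) = M - b - j by linarith,
      show (((j + b : ℤ) : ℚ)) ^ 2 = (b : ℚ) ^ 2 + j * (j + (2 * b : ℤ)) by push_cast; ring,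
      qpow_add]
    ring
  · exact support_finite_of_bounds 0 x fun j hj =>
      gaussian_ne_zero_bounds (right_ne_zero_of_mul (left_ne_zero_of_mul hj))

/-- The Burge transform in the limit `M → ∞`. -/
theorem burge_transform_limit (N : ℕ) {a b : ℤ} (hab : 0 ≤ a ∧ 0 ≤ b ∨ a ≤ 0 ∧ b ≤ 0) :
    ∑ i ∈ Finset.range (N + 1), qpow ((i : ℚ) ^ 2) * burgeB (N - i) i a b
      = qpow ((b : ℚ) ^ 2) * gaussian (2 * N) (N - (a + b)) := by
  by_cases hN : 0 ≤ N + a - b ∧ 0 ≤ N - a + b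
  swap
  · trans (0 : QField)
    · refine Finset.sum_eq_zero fun i _ => ?_
      by_contra h
      have := burgeB_ne_zero_bounds (right_ne_zero_of_mul h)
      omega
    · by_contra h
      have := gaussian_ne_zero_bounds (right_ne_zero_of_mul (Ne.symm h))
      omega
  obtain ⟨x, hx⟩ := Int.eq_ofNat_of_zero_le hN.1
  obtain ⟨y, hy⟩ := Int.eq_ofNat_of_zero_le hN.2
  trans ∑ᶠ i : ℤ, qpow ((i : ℚ) ^ 2) * burgeB (N - i) i a b
  · rw [finsum_int_eq_sum_range (N := N)]
    · simp
    · intro i hi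
      have := burgeB_ne_zero_bounds (right_ne_zero_of_mul hi)
      omega
  rw [← finsum_shift _ b]
  have hR : gaussian (2 * N) (N - (a + b)) = gaussian (x + y) (x + 2 * b) := by
    rw [← gaussian_symm (x + y)]
    congr 1 <;> linarith
  rw [hR, ← gaussian_vandermonde, mul_finsum']
  · refine finsum_congr fun j => ?_
    rw [burgeB_sub_natCast x y hx hy,
      show (((j + b : ℤ) : ℚ)) ^ 2 = (b : ℚ) ^ 2 + j * (j + (2 * b : ℤ)) by push_cast; ring,
      qpow_add]
    ring
  · exact support_finite_of_bounds 0 x fun j hj =>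
      gaussian_ne_zero_bounds (right_ne_zero_of_mul (left_ne_zero_of_mul hj))

/-- The summand of the two-variable bosonic polynomial. -/
def burgeTerm (p p' r s N M k : ℤ) : QField :=
  qpow (((k ^ 2 * p * p' + k * (p' * r - p * s) : ℤ) : ℚ)) * burgeB N M (p' * k) (p * k) -
    qpow ((((k * p + r) * (k * p' + s) : ℤ) : ℚ)) * burgeB N M (k * p' + s) (k * p + r)

/-- The two-variable bosonic polynomial of the `(p, p')` model. -/
def burgePoly (p p' r s N M : ℤ) : QField := ∑ᶠ k, burgeTerm p p' r s N M k

theorem bounds_of_abs_mul_le {p' : ℤ} (hp' : 0 < p') {k s N : ℤ} (h1 : 0 ≤ N + (k * p' + s))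
    (h2 : 0 ≤ N - (k * p' + s)) : -(|N| + |s|) ≤ k ∧ k ≤ |N| + |s| := by
  have := le_abs_self N
  have := le_abs_self s
  have := neg_abs_le s
  constructor <;> by_contra h <;> nlinarith [abs_nonneg N, abs_nonneg s]

theorem burgeB_hasFiniteSupport {p' : ℤ} (hp' : 0 < p') (s N M : ℤ) (f : ℤ → QField)
    (g : ℤ → ℤ) : (fun k => f k * burgeB N M (k * p' + s) (g k)).HasFiniteSupport :=
  support_finite_of_bounds _ _ fun _ hk =>
    have := burgeB_ne_zero_bounds (right_ne_zero_of_mul hk)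
    bounds_of_abs_mul_le hp' this.1 this.2.1

theorem burgeB_hasFiniteSupport' {p' : ℤ} (hp' : 0 < p') (N M : ℤ) (f : ℤ → QField)
    (g : ℤ → ℤ) : (fun k => f k * burgeB N M (p' * k) (g k)).HasFiniteSupport := by
  have h := burgeB_hasFiniteSupport hp' 0 N M f g
  simp only [add_zero] at h
  simpa only [mul_comm p'] using h

theorem burgeTerm_hasFiniteSupport (p : ℤ) {p' : ℤ} (hp' : 0 < p') (r s N M : ℤ) :
    (burgeTerm p p' r s N M).HasFiniteSupport :=
  ((burgeB_hasFiniteSupport' hp' N M _ _).union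
    (burgeB_hasFiniteSupport hp' s N M _ _)).subset (Function.support_sub _ _)

theorem burgePoly_eq_sub (p : ℤ) {p' : ℤ} (hp' : 0 < p') (r s N M : ℤ) :
    burgePoly p p' r s N M =
      (∑ᶠ k : ℤ, qpow (((k ^ 2 * p * p' + k * (p' * r - p * s) : ℤ) : ℚ)) *
        burgeB N M (p' * k) (p * k)) -
      ∑ᶠ k : ℤ, qpow ((((k * p + r) * (k * p' + s) : ℤ) : ℚ)) *
        burgeB N M (k * p' + s) (k * p + r) :=
  finsum_sub_distrib (burgeB_hasFiniteSupport' hp' N M _ _) (burgeB_hasFiniteSupport hp' s N M _ _)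

theorem burgeB_neg (N M a b : ℤ) : burgeB N M (-a) (-b) = burgeB N M a b := by
  rw [burgeB, burgeB, mul_comm]
  congr 2 <;> ring

/-- The first sum needs k ↦ -k, since its linear exponent changes sign; the second is symmetric term
by term. -/
theorem burgePoly_swap {p p' : ℤ} (hp : 0 < p) (hp' : 0 < p') (r s N M : ℤ) :
    burgePoly p p' r s N M = burgePoly p' p s r M N := by
  rw [burgePoly_eq_sub p hp', burgePoly_eq_sub p' hp]
  congr 1
  · rw [← finsum_comp_equiv (Equiv.neg ℤ)]
    refine finsum_congr fun k => ?_
    rw [Equiv.neg_apply, mul_neg, mul_neg, burgeB_neg, burgeB_swap]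
    congr 3
    ring
  · refine finsum_congr fun k => ?_
    rw [burgeB_swap, mul_comm (k * p + r)]

/-- This supplies the sign hypothesis of the Burge transform for every `k`. -/
theorem same_sign {p d r u : ℤ} (hp : 0 < p) (hd : 0 < d) (hr : 0 ≤ r) (hrp : r ≤ p) (hu : 0 ≤ u)
    (hud : u ≤ d) (k : ℤ) : 0 ≤ k * d + u ∧ 0 ≤ k * p + r ∨ k * d + u ≤ 0 ∧ k * p + r ≤ 0 := by
  rcases le_or_gt 0 k with hk | hk
  · left; constructor <;> positivity
  · right; constructor <;> nlinarith

/-- The Burge transform acts termwise with (a, b) = (dk, pk) and (kd + u, kp + r): replacing a by a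
+ b adds p to d and r to u, and the factor q^(b²) is the change in the exponent. -/
theorem burgePoly_step {p d r u : ℤ} (hp : 0 < p) (hd : 0 < d) (hr : 0 ≤ r) (hrp : r ≤ p)
    (hu : 0 ≤ u) (hud : u ≤ d) (N : ℕ) (M : ℤ) :
    burgePoly p (d + p) r (u + r) N M = ∑ i ∈ Finset.range (N + 1),
      qpow ((i : ℚ) ^ 2) * gaussian (2 * N + M - i) (2 * N) * burgePoly p d r u (N - i) i := by
  unfold burgePoly
  have h1 : ∀ i : ℕ, (fun k => qpow ((i : ℚ) ^ 2) * gaussian (2 * N + M - i) (2 * N) *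
      burgeTerm p d r u (N - i) i k).HasFiniteSupport := fun i =>
    (burgeTerm_hasFiniteSupport p hd r u (N - i) i).subset fun k hk => right_ne_zero_of_mul hk
  simp_rw [fun i : ℕ => mul_finsum' (burgeTerm p d r u (N - i) i)
    (qpow ((i : ℚ) ^ 2) * gaussian (2 * N + M - i) (2 * N)) (burgeTerm_hasFiniteSupport p hd r u (N - i) i)]
  rw [← finsum_sum_comm _ _ fun i _ => h1 i]
  refine finsum_congr fun k => ?_
  simp_rw [burgeTerm, mul_sub (_ : QField), Finset.sum_sub_distrib]
  congr 1
  · have hk := burge_transform N M (a := d * k) (b := p * k) (by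
      simpa [mul_comm] using same_sign hp hd le_rfl hp.le le_rfl hd.le k)
    rw [show d * k + p * k = (d + p) * k by ring] at hk
    have he : qpow (((k ^ 2 * p * (d + p) + k * ((d + p) * r - p * (u + r)) : ℤ) : ℚ))
        = qpow (((k ^ 2 * p * d + k * (d * r - p * u) : ℤ) : ℚ)) * qpow (((p * k : ℤ) : ℚ) ^ 2) := by
      rw [← qpow_add]; push_cast; ring_nf
    rw [he, mul_assoc, ← hk, Finset.mul_sum]
    exact Finset.sum_congr rfl fun i _ => by ring
  · have hk := burge_transform N M (same_sign hp hd hr hrp hu hud k)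
    rw [show k * d + u + (k * p + r) = k * (d + p) + (u + r) by ring] at hk
    have he : qpow ((((k * p + r) * (k * (d + p) + (u + r)) : ℤ) : ℚ))
        = qpow ((((k * p + r) * (k * d + u) : ℤ) : ℚ)) * qpow (((k * p + r : ℤ) : ℚ) ^ 2) := by
      rw [← qpow_add]; push_cast; ring_nf
    rw [he, mul_assoc, ← hk, Finset.mul_sum]
    exact Finset.sum_congr rfl fun i _ => by ring

theorem burgePoly_one_one (N M : ℕ) :
    burgePoly 1 1 0 1 N M = if N = 0 ∧ M = 0 then 1 else 0 := by
  split_ifs with h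
  · obtain ⟨rfl, rfl⟩ := h
    rw [burgePoly, finsum_eq_single _ 0]
    · simp [burgeTerm, burgeB, gaussian_zero_left, qpow_zero, gaussian_of_neg]
    · intro k hk
      have h1 : gaussian 0 k = 0 := by rw [gaussian_zero_left, if_neg hk]
      have h2 : gaussian (-1) (-1 - k) = 0 := if_neg (by omega)
      have h3 : -(k + 1) = -1 - k := by ring
      simp [burgeTerm, burgeB, h1, h2, h3]
  · have hn : (N : ℤ) + M ≠ 0 := by omega
    -- This is a telescoping certificate. After shifting the second sum by one, Pascal's rule in one
    -- factor of each product leaves a common term that cancels, and the rest is `f k - f (k - 1)`.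
    -- The rule for `gaussian (N + M)` requires N + M ≠ 0.
    set f : ℤ → QField := fun k => qpow (M + (k : ℚ) ^ 2) *
      (gaussian (N + M) (N + k) * gaussian (N + M - 1) (N - k - 1)) with hf
    have hfs : f.HasFiniteSupport := support_finite_of_bounds (-N) N fun k hk => by
      have h1 := gaussian_ne_zero_bounds (left_ne_zero_of_mul (right_ne_zero_of_mul hk))
      have h2 := gaussian_ne_zero_bounds (right_ne_zero_of_mul (right_ne_zero_of_mul hk))
      omega
    have hfs' : (fun k => f (k + -1)).HasFiniteSupport :=
      hfs.preimage (Function.Injective.injOn fun a b hab => by simpa using hab)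
    set g₁ : ℤ → QField := fun k => qpow (((k ^ 2 * 1 * 1 + k * (1 * 0 - 1 * 1) : ℤ) : ℚ)) *
        burgeB N M (1 * k) (1 * k) with hg₁
    set g₂ : ℤ → QField := fun k => qpow ((((k * 1 + 0) * (k * 1 + 1) : ℤ) : ℚ)) *
        burgeB N M (k * 1 + 1) (k * 1 + 0) with hg₂
    have hgs₁ : g₁.HasFiniteSupport := burgeB_hasFiniteSupport' one_pos N M
      (fun k => qpow (((k ^ 2 * 1 * 1 + k * (1 * 0 - 1 * 1) : ℤ) : ℚ))) (fun k => 1 * k)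
    have hgs₂ : g₂.HasFiniteSupport := burgeB_hasFiniteSupport one_pos 1 N M
      (fun k => qpow ((((k * 1 + 0) * (k * 1 + 1) : ℤ) : ℚ))) (fun k => k * 1 + 0)
    have hgs₂' : (fun k => g₂ (k + -1)).HasFiniteSupport :=
      hgs₂.preimage (Function.Injective.injOn fun a b hab => by simpa using hab)
    have hstep : ∀ k, g₁ k - g₂ (k + -1) = f k - f (k + -1) := by
      intro k
      have e1 : gaussian ((N : ℤ) + M) (N - k) = qpow (M + (k : ℚ)) *
          gaussian (N + M - 1) (N - k - 1) + gaussian (N + M - 1) (N - k) := by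
        rw [gaussian_pascal' (Or.inl hn)]
        push_cast; ring_nf
      have e2 : gaussian ((N : ℤ) + M + 1) (N + k) = qpow (M + 1 - (k : ℚ)) *
          gaussian (N + M) (N + k - 1) + gaussian (N + M) (N + k) := by
        rw [gaussian_pascal' (Or.inl (by omega))]
        push_cast; ring_nf
      have h1 : g₁ k = qpow ((k : ℚ) ^ 2 - k) *
          (gaussian (N + M) (N + k) * gaussian (N + M) (N - k)) := by
        simp only [hg₁, burgeB]
        congr 2 <;> (push_cast; ring_nf)
      have h2 : g₂ (k + -1) = qpow ((k : ℚ) ^ 2 - k) *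
          (gaussian (N + M + 1) (N + k) * gaussian (N + M - 1) (N - k)) := by
        simp only [hg₂, burgeB]
        congr 2 <;> (push_cast; ring_nf)
      have h3 : f k = qpow ((k : ℚ) ^ 2 - k) * qpow (M + (k : ℚ)) *
          (gaussian (N + M) (N + k) * gaussian (N + M - 1) (N - k - 1)) := by
        rw [← qpow_add, hf]
        ring_nf
      have h4 : f (k + -1) = qpow ((k : ℚ) ^ 2 - k) * qpow (M + 1 - (k : ℚ)) *
          (gaussian (N + M) (N + k - 1) * gaussian (N + M - 1) (N - k)) := by
        rw [← qpow_add, hf]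
        simp only
        push_cast
        ring_nf
      rw [h1, h2, h3, h4, e1, e2]
      ring
    rw [burgePoly_eq_sub 1 one_pos]
    change ∑ᶠ k, g₁ k - ∑ᶠ k, g₂ k = 0
    rw [← finsum_shift g₂ (-1), ← finsum_sub_distrib hgs₁ hgs₂', finsum_congr hstep,
      finsum_sub_distrib hfs hfs', finsum_shift, sub_self]

/-- One Burge step from (1, 1), where the polynomial at (N - i, i) is nonzero only if i = N = 0.
This is the end of the Euclidean recursion. -/
theorem burgePoly_one_two (N : ℕ) (M : ℤ) (h : 0 ≤ N + M) :
    burgePoly 1 2 0 1 N M = if N = 0 then 1 else 0 := by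
  have key := burgePoly_step (p := 1) (d := 1) (r := 0) (u := 1) one_pos one_pos le_rfl zero_le_one
    zero_le_one le_rfl N M
  rw [show (1 : ℤ) + 1 = 2 by norm_num, show (1 : ℤ) + 0 = 1 by norm_num] at key
  have hterm : ∀ i ∈ Finset.range (N + 1), burgePoly 1 1 0 1 (N - i : ℤ) i =
      if N = 0 then 1 else 0 := by
    intro i hi
    have hi' : i ≤ N := Nat.lt_succ_iff.mp (Finset.mem_range.mp hi)
    rw [← Nat.cast_sub hi', burgePoly_one_one]
    congr 1
    simp only [eq_iff_iff]
    omega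
  rw [key, Finset.sum_congr rfl fun i hi => by rw [hterm i hi]]
  split_ifs with hN
  · subst hN
    simp [qpow_zero, gaussian_zero_right (show 0 ≤ M by simpa using h)]
  · simp

/-! ### The Euclidean algorithm on continued fractions and the nested fermionic sum. -/

/-- The exponent `e` of a fermionic row: the row contributes `q ^ (e ^ 2)`. -/
def rowExp (b : Bool) (N k : ℤ) : ℤ := if b then k else N - k

/-- The weight of a fermionic row; `b` tells whether the row is a zone end, and the arguments are
the halves of three consecutive entries of `m`. -/
def rowWeight (b : Bool) (A N k : ℤ) : QField :=
  qpow ((rowExp b N k : ℚ) ^ 2) * gaussian (A + N - rowExp b N k) (2 * N)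

/-- The iterated fermionic sum attached to a list of rows. -/
def fermi : List Bool → ℕ → ℕ → QField
  | [], _, N => if N = 0 then 1 else 0
  | b :: z, A, N => ∑ k ∈ Finset.range (N + 1), rowWeight b A N k * fermi z N k

/-- The list of rows `1, 2, …` (or `0, 1, …`) attached to a continued fraction, with `true` marking
the zone ends. -/
def rows : List ℕ → List Bool
  | [] => []
  | [a] => List.replicate (a - 2) false
  | a :: b :: l => List.replicate (a - 1) false ++ true :: rows (b :: l)

/-- Normalised continued fractions with positive entries. -/
def ValidCF : List ℕ → Prop
  | [] => False
  | [a] => 2 ≤ a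
  | a :: b :: l => 1 ≤ a ∧ ValidCF (b :: l)

theorem ValidCF.one_lt_cfValue : ∀ {c : List ℕ}, ValidCF c → 1 < cfValue c
  | [a], h => by
    have : (2 : ℚ) ≤ a := by exact_mod_cast h
    simp only [cfValue]; linarith
  | a :: b :: l, h => by
    have ih := ValidCF.one_lt_cfValue h.2
    have ha : (1 : ℚ) ≤ a := by exact_mod_cast h.1
    have : 0 < 1 / cfValue (b :: l) := by positivity
    simp only [cfValue]; linarith

/-- Solutions `(r, s)` of `p s - p' r = ±1` in the lower half of the fundamental range. -/
structure HalfSolution (p p' r s : ℤ) : Prop where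
  p_pos : 0 < p
  p'_pos : 0 < p'
  r_nonneg : 0 ≤ r
  r_le : 2 * r ≤ p
  s_nonneg : 0 ≤ s
  s_le : 2 * s ≤ p'
  det : p * s - p' * r = 1 ∨ p * s - p' * r = -1

theorem HalfSolution.swap {p p' r s : ℤ} (h : HalfSolution p p' r s) : HalfSolution p' p s r :=
  ⟨h.p'_pos, h.p_pos, h.s_nonneg, h.s_le, h.r_nonneg, h.r_le, by have := h.det; omega⟩

theorem HalfSolution.le {p p' r s : ℤ} (h : HalfSolution p p' r s) (hlt : p < p') : r ≤ s := by
  obtain ⟨hp, -, hr, hr2, hs0, -, hd⟩ := h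
  by_contra hs
  have h1 : 0 < (p' - p) * r := mul_pos (by omega) (by omega)
  have h2 : p * s ≤ p * (r - 1) := mul_le_mul_of_nonneg_left (by omega) hp.le
  rcases hd with hd | hd <;> nlinarith

/-- The excluded pair (1, 2), with r = 0 and s = 1, is where the recursion stops; there 2(s - r)
exceeds p' - p. -/
theorem HalfSolution.sub {p p' r s : ℤ} (h : HalfSolution p p' r s) (hlt : p < p')
    (h2 : ¬(p = 1 ∧ p' = 2)) : HalfSolution p (p' - p) r (s - r) := by
  have hle := h.le hlt
  obtain ⟨hp, hp', hr, hr2, hs, hs2, hd⟩ := h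
  refine ⟨hp, by omega, hr, hr2, by omega, ?_, by
    rcases hd with hd | hd
    · left; linarith
    · right; linarith⟩
  by_contra hcon
  -- Put e = p' - 2s and f = p - 2r, so that p'f - pe = ±2. Failure of the bound means e ≤ f - 1,
  -- hence (p' - p)f + p ≤ 2.
  have h3 : p ≤ 2 := by
    by_contra h3
    rcases hd with hd | hd <;> nlinarith
  obtain rfl | rfl : p = 1 ∨ p = 2 := by omega
  · obtain rfl : r = 0 := by omega
    omega
  · obtain rfl | rfl : r = 0 ∨ r = 1 := by omega
    all_goals omega

theorem rows_eq_nil {c : List ℕ} (hc : ValidCF c) (h : rows c = []) : c = [2] := by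
  match c, hc, h with
  | [a], hc, h =>
    have h' : a - 2 = 0 := by simpa [rows] using h
    have : 2 ≤ a := hc
    rw [show a = 2 by omega]
  | a :: b :: l, hc, h => simp [rows] at h

/-- A `false` row lowers the leading coefficient by one; a `true` row occurs when that coefficient
is 1 and removes it, inverting the remainder. -/
theorem rows_eq_cons {c : List ℕ} (hc : ValidCF c) {b : Bool} {z : List Bool}
    (h : rows c = b :: z) : ∃ c', rows c' = z ∧ ValidCF c' ∧
      (b = false → cfValue c = cfValue c' + 1) ∧ (b = true → cfValue c = 1 + 1 / cfValue c') := by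
  match c, hc, h with
  | [a], hc, h =>
    have ha : 2 ≤ a := hc
    obtain ⟨n, hn⟩ : ∃ n, a - 2 = n + 1 := by
      rcases hn : a - 2 with _ | n
      · simp [rows, hn] at h
      · exact ⟨n, rfl⟩
    rw [rows, hn, List.replicate_succ, List.cons.injEq] at h
    refine ⟨[n + 2], by simpa [rows] using h.2, Nat.le_add_left _ _, fun _ => ?_, fun hb => ?_⟩
    · rw [show a = n + 3 by omega]
      simp only [cfValue]; push_cast; ring
    · simp [hb] at h
  | 1 :: x :: l, hc, h =>
    simp only [rows, Nat.sub_self, List.replicate_zero, List.nil_append, List.cons.injEq] at h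
    refine ⟨x :: l, h.2, hc.2, fun hb => by simp [hb] at h, fun _ => by simp [cfValue]⟩
  | (n + 2) :: x :: l, hc, h =>
    simp only [rows, show n + 2 - 1 = n + 1 by omega, List.replicate_succ, List.cons_append,
      List.cons.injEq] at h
    refine ⟨(n + 1) :: x :: l, by simpa [rows] using h.2, ⟨by omega, hc.2⟩, fun _ => ?_,
      fun hb => by simp [hb] at h⟩
    simp only [cfValue]; push_cast; ring
  | 0 :: x :: l, hc, h => exact absurd hc.1 (by omega)

theorem lt_of_eq_mul_cfValue {c : List ℕ} (hc : ValidCF c) {p p' : ℤ} (hp : 0 < p)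
    (h : (p' : ℚ) = p * cfValue c) : p < p' := by
  have := hc.one_lt_cfValue
  have hp' : (0 : ℚ) < p := by exact_mod_cast hp
  have : (p : ℚ) < p' := by rw [h]; nlinarith
  exact_mod_cast this

/-- One step of the Euclidean algorithm on continued fractions. -/
theorem rows_reduce {c : List ℕ} (hc : ValidCF c) {b : Bool} {z : List Bool}
    (h : rows c = b :: z) {p p' r s : ℤ} (hs : HalfSolution p p' r s)
    (hv : (p' : ℚ) = p * cfValue c) : ∃ c', rows c' = z ∧ ValidCF c' ∧
      (b = false → HalfSolution p (p' - p) r (s - r) ∧ ((p' - p : ℤ) : ℚ) = p * cfValue c') ∧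
      (b = true → HalfSolution (p' - p) p (s - r) r ∧ (p : ℚ) = (p' - p : ℤ) * cfValue c') := by
  have hlt := lt_of_eq_mul_cfValue hc hs.p_pos hv
  obtain ⟨c', h1, h2, h3, h4⟩ := rows_eq_cons hc h
  have hone := h2.one_lt_cfValue
  have hp : (0 : ℚ) < p := by exact_mod_cast hs.p_pos
  -- Value 2 would force `cfValue c' = 1`, whereas every valid continued fraction exceeds 1.
  have hne : ¬(p = 1 ∧ p' = 2) := by
    rintro ⟨rfl, rfl⟩
    rcases b with _ | _
    · rw [h3 rfl] at hv
      push_cast at hv; linarith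
    · rw [h4 rfl] at hv
      have : 1 / cfValue c' < 1 := by rw [div_lt_one (by linarith)]; exact hone
      push_cast at hv; linarith
  refine ⟨c', h1, h2, fun hb => ⟨hs.sub hlt hne, ?_⟩, fun hb => ⟨(hs.sub hlt hne).swap, ?_⟩⟩
  · push_cast; rw [hv, h3 hb]; ring
  · push_cast; rw [hv, h4 hb]; field_simp; ring

/-- Reindexing a Burge sum this way makes `k` the first argument of the next polynomial, whether or
not p and p' are swapped. -/
theorem sum_range_rowExp (b : Bool) (N : ℕ) (f : ℤ → QField) :
    ∑ k ∈ Finset.range (N + 1), f (rowExp b N k) = ∑ i ∈ Finset.range (N + 1), f i := by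
  cases b
  · rw [← Finset.sum_range_reflect]
    refine Finset.sum_congr rfl fun k hk => ?_
    have := Finset.mem_range.mp hk
    simp only [rowExp, Bool.false_eq_true, if_false]
    congr 1
    omega
  · rfl

/-- The second argument is `A - N`, with `A` the preceding entry. Then 2N + M - i = A + N - i is the
top of the row's Gaussian polynomial, and the next polynomial has arguments (k, N - k), again of
this form. -/
theorem burgePoly_eq_fermi {z : List Bool} : ∀ {c : List ℕ}, rows c = z → ValidCF c →
    ∀ {p p' r s : ℤ}, HalfSolution p p' r s → (p' : ℚ) = p * cfValue c →
    ∀ A N : ℕ, burgePoly p p' r s N (A - N) = fermi z A N := by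
  induction z with
  | nil =>
    intro c hcz hc p p' r s hs hv A N
    obtain rfl := rows_eq_nil hc hcz
    have hv' : p' = p * 2 := by
      simp only [cfValue] at hv
      exact_mod_cast hv
    obtain ⟨hp, -, hr, hr2, hs0, hs2, hd⟩ := hs
    subst hv'
    have hp1 : p = 1 := by
      have hu : IsUnit p := by
        rcases hd with hd | hd
        · exact IsUnit.of_mul_eq_one (s - 2 * r) (by linarith)
        · exact IsUnit.of_mul_eq_one (2 * r - s) (by linarith)
      rcases Int.isUnit_iff.mp hu with h | h <;> omega
    subst hp1
    obtain rfl : r = 0 := by omega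
    obtain rfl : s = 1 := by omega
    exact burgePoly_one_two N _ (by omega)
  | cons b z ih =>
    intro c hcz hc p p' r s hs hv A N
    have hlt := lt_of_eq_mul_cfValue hc hs.p_pos hv
    obtain ⟨c', hz, hc', hf, ht⟩ := rows_reduce hc hcz hs hv
    have hsub : HalfSolution p (p' - p) r (s - r) := by
      cases b
      exacts [(hf rfl).1, (ht rfl).1.swap]
    have key := burgePoly_step hsub.p_pos hsub.p'_pos hsub.r_nonneg
      (by linarith [hsub.r_le, hsub.r_nonneg]) hsub.s_nonneg
      (by linarith [hsub.s_le, hsub.s_nonneg]) N (A - N)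
    rw [sub_add_cancel, sub_add_cancel] at key
    rw [key, fermi]
    have := sum_range_rowExp b N fun i => qpow ((i : ℚ) ^ 2) * gaussian (2 * N + (A - N) - i) (2 * N)
        * burgePoly p (p' - p) r (s - r) (N - i) i
    simp only [Int.cast_natCast] at this
    rw [← this]
    refine Finset.sum_congr rfl fun k _ => ?_
    rw [rowWeight, show (2 * (N : ℤ) + (A - N) - rowExp b N k) = A + N - rowExp b N k by ring]
    congr 1
    cases b
    · rw [← ih hz hc' (hf rfl).1 (hf rfl).2, rowExp, if_neg (by simp), sub_sub_cancel]
    · rw [← ih hz hc' (ht rfl).1 (ht rfl).2, rowExp, if_pos rfl,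
        burgePoly_swap hsub.p_pos hsub.p'_pos]

/-! ### The one-variable bosonic polynomials: first Burge step, recurrences and boundary values. -/

/-- The one-variable bosonic polynomial. -/
def bosonic (p p' a r L K : ℤ) : QField :=
  ∑ᶠ k : ℤ, (qpow (((k ^ 2 * p * p' + k * (p' * r - p * a) : ℤ) : ℚ)) * gaussian L (K - k * p') -
    qpow ((((k * p + r) * (k * p' + a) : ℤ) : ℚ)) * gaussian L (K - (k * p' + a)))

theorem bosonic_step {p d r u : ℤ} (hp : 0 < p) (hd : 0 < d) (hr : 0 ≤ r) (hrp : r ≤ p)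
    (hu : 0 ≤ u) (hud : u ≤ d) (N : ℕ) :
    bosonic p (d + p) (u + r) r (2 * N) N = ∑ i ∈ Finset.range (N + 1),
      qpow ((i : ℚ) ^ 2) * burgePoly p d r u (N - i) i := by
  unfold burgePoly bosonic
  have h1 : ∀ i : ℕ, (fun k => qpow ((i : ℚ) ^ 2) *
      burgeTerm p d r u (N - i) i k).HasFiniteSupport := fun i =>
    (burgeTerm_hasFiniteSupport p hd r u (N - i) i).subset fun k hk => right_ne_zero_of_mul hk
  simp_rw [fun i : ℕ => mul_finsum' (burgeTerm p d r u (N - i) i)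
    (qpow ((i : ℚ) ^ 2)) (burgeTerm_hasFiniteSupport p hd r u (N - i) i)]
  rw [← finsum_sum_comm _ _ fun i _ => h1 i]
  refine finsum_congr fun k => ?_
  simp_rw [burgeTerm, mul_sub (_ : QField), Finset.sum_sub_distrib]
  congr 1
  · have hk := burge_transform_limit N (a := d * k) (b := p * k) (by
      simpa [mul_comm] using same_sign hp hd le_rfl hp.le le_rfl hd.le k)
    rw [show d * k + p * k = k * (d + p) by ring] at hk
    have he : qpow (((k ^ 2 * p * (d + p) + k * ((d + p) * r - p * (u + r)) : ℤ) : ℚ))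
        = qpow (((k ^ 2 * p * d + k * (d * r - p * u) : ℤ) : ℚ)) * qpow (((p * k : ℤ) : ℚ) ^ 2) := by
      rw [← qpow_add]; push_cast; ring_nf
    rw [he, mul_assoc, ← hk, Finset.mul_sum]
    exact Finset.sum_congr rfl fun i _ => by ring
  · have hk := burge_transform_limit N (same_sign hp hd hr hrp hu hud k)
    rw [show k * d + u + (k * p + r) = k * (d + p) + (u + r) by ring] at hk
    have he : qpow ((((k * p + r) * (k * (d + p) + (u + r)) : ℤ) : ℚ))
        = qpow ((((k * p + r) * (k * d + u) : ℤ) : ℚ)) * qpow (((k * p + r : ℤ) : ℚ) ^ 2) := by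
      rw [← qpow_add]; push_cast; ring_nf
    rw [he, mul_assoc, ← hk, Finset.mul_sum]
    exact Finset.sum_congr rfl fun i _ => by ring

theorem bosonic_eq_fermi {c : List ℕ} (hc : ValidCF c) {b : Bool} {z : List Bool}
    (hcz : rows c = b :: z) {p p' r s : ℤ} (hs : HalfSolution p p' r s)
    (hv : (p' : ℚ) = p * cfValue c) (N : ℕ) :
    bosonic p p' s r (2 * N) N = ∑ k ∈ Finset.range (N + 1),
      qpow ((rowExp b N k : ℚ) ^ 2) * fermi z N k := by
  obtain ⟨c', hz, hc', hf, ht⟩ := rows_reduce hc hcz hs hv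
  have hsub : HalfSolution p (p' - p) r (s - r) := by
    cases b
    exacts [(hf rfl).1, (ht rfl).1.swap]
  have key := bosonic_step hsub.p_pos hsub.p'_pos hsub.r_nonneg
    (by linarith [hsub.r_le, hsub.r_nonneg]) hsub.s_nonneg
    (by linarith [hsub.s_le, hsub.s_nonneg]) N
  rw [sub_add_cancel, sub_add_cancel] at key
  rw [key]
  have := sum_range_rowExp b N fun i => qpow ((i : ℚ) ^ 2)
      * burgePoly p (p' - p) r (s - r) (N - i) i
  simp only [Int.cast_natCast] at this
  rw [← this]
  refine Finset.sum_congr rfl fun k _ => ?_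
  congr 1
  cases b
  · rw [← burgePoly_eq_fermi hz hc' (hf rfl).1 (hf rfl).2, rowExp, if_neg (by simp), sub_sub_cancel]
  · rw [← burgePoly_eq_fermi hz hc' (ht rfl).1 (ht rfl).2, rowExp, if_pos rfl,
      burgePoly_swap hsub.p_pos hsub.p'_pos]

theorem gaussian_hasFiniteSupport {p' : ℤ} (hp' : 0 < p') (s L K : ℤ) (f : ℤ → QField) :
    (fun k => f k * gaussian L (K - (k * p' + s))).HasFiniteSupport := by
  refine support_finite_of_bounds (-(|K| + |L| + |s|)) (|K| + |L| + |s|) fun k hk => ?_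
  have h := gaussian_ne_zero_bounds (right_ne_zero_of_mul hk)
  have := le_abs_self L
  have := le_abs_self K
  have := neg_abs_le K
  have := le_abs_self s
  have := neg_abs_le s
  constructor <;> by_contra hc <;> nlinarith [abs_nonneg K, abs_nonneg L, abs_nonneg s]

theorem gaussian_hasFiniteSupport' {p' : ℤ} (hp' : 0 < p') (L K : ℤ) (f : ℤ → QField) :
    (fun k => f k * gaussian L (K - k * p')).HasFiniteSupport := by
  simpa only [add_zero] using gaussian_hasFiniteSupport hp' 0 L K f

theorem bosonic_hasFiniteSupport (p : ℤ) {p' : ℤ} (hp' : 0 < p') (a r L K : ℤ) :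
    (fun k : ℤ => (qpow (((k ^ 2 * p * p' + k * (p' * r - p * a) : ℤ) : ℚ)) *
      gaussian L (K - k * p') -
    qpow ((((k * p + r) * (k * p' + a) : ℤ) : ℚ)) *
      gaussian L (K - (k * p' + a)))).HasFiniteSupport :=
  ((gaussian_hasFiniteSupport' hp' L K _).union
    (gaussian_hasFiniteSupport hp' a L K _)).subset (Function.support_sub _ _)

theorem bosonic_eq_sub (p : ℤ) {p' : ℤ} (hp' : 0 < p') (a r L K : ℤ) :
    bosonic p p' a r L K =
      (∑ᶠ k : ℤ, qpow (((k ^ 2 * p * p' + k * (p' * r - p * a) : ℤ) : ℚ)) *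
        gaussian L (K - k * p')) -
      ∑ᶠ k : ℤ, qpow ((((k * p + r) * (k * p' + a) : ℤ) : ℚ)) *
        gaussian L (K - (k * p' + a)) :=
  finsum_sub_distrib (gaussian_hasFiniteSupport' hp' L K _) (gaussian_hasFiniteSupport hp' a L K _)

/-- The power of q from Pascal's rule depends on `k` in just the way absorbed by r ↦ r - 1; in
`bosonic_succ'` the other rule is absorbed by r ↦ r + 1. -/
theorem bosonic_succ (p : ℤ) {p' : ℤ} (hp' : 0 < p') (a r : ℤ) (L : ℕ) (K : ℤ) :
    bosonic p p' a r (L + 1) K =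
      qpow K * bosonic p p' a (r - 1) L K + bosonic p p' a r L (K - 1) := by
  unfold bosonic
  rw [mul_finsum' _ _ (bosonic_hasFiniteSupport p hp' a (r - 1) L K), ← finsum_add_distrib]
  · refine finsum_congr fun k => ?_
    have h1 : qpow (((k ^ 2 * p * p' + k * (p' * r - p * a) : ℤ) : ℚ)) *
        qpow ((K - k * p' : ℤ) : ℚ) =
        qpow K * qpow (((k ^ 2 * p * p' + k * (p' * (r - 1) - p * a) : ℤ) : ℚ)) := by
      rw [← qpow_add, ← qpow_add]; push_cast; ring_nf
    have h2 : qpow ((((k * p + r) * (k * p' + a) : ℤ) : ℚ)) * qpow ((K - (k * p' + a) : ℤ) : ℚ) =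
        qpow K * qpow ((((k * p + (r - 1)) * (k * p' + a) : ℤ) : ℚ)) := by
      rw [← qpow_add, ← qpow_add]; push_cast; ring_nf
    rw [gaussian_pascal (A := (L : ℤ) + 1) (B := K - k * p') (by omega),
      gaussian_pascal (A := (L : ℤ) + 1) (B := K - (k * p' + a)) (by omega), add_sub_cancel_right,
      show K - k * p' - 1 = K - 1 - k * p' by ring,
      show K - (k * p' + a) - 1 = K - 1 - (k * p' + a) by ring]
    linear_combination gaussian L (K - k * p') * h1 - gaussian L (K - (k * p' + a)) * h2
  · exact (bosonic_hasFiniteSupport p hp' a (r - 1) L K).subset fun k hk => right_ne_zero_of_mul hk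
  · exact bosonic_hasFiniteSupport p hp' a r L (K - 1)

theorem bosonic_succ' (p : ℤ) {p' : ℤ} (hp' : 0 < p') (a r : ℤ) (L : ℕ) (K : ℤ) :
    bosonic p p' a r (L + 1) K =
      bosonic p p' a r L K + qpow (L + 1 - K) * bosonic p p' a (r + 1) L (K - 1) := by
  unfold bosonic
  rw [mul_finsum' _ _ (bosonic_hasFiniteSupport p hp' a (r + 1) L (K - 1)), ← finsum_add_distrib]
  · refine finsum_congr fun k => ?_
    have h1 : qpow (((k ^ 2 * p * p' + k * (p' * r - p * a) : ℤ) : ℚ)) *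
        qpow ((((L : ℤ) + 1 : ℤ) : ℚ) - ((K - k * p' : ℤ) : ℚ)) = qpow (L + 1 - K) *
        qpow (((k ^ 2 * p * p' + k * (p' * (r + 1) - p * a) : ℤ) : ℚ)) := by
      rw [← qpow_add, ← qpow_add]; push_cast; ring_nf
    have h2 : qpow ((((k * p + r) * (k * p' + a) : ℤ) : ℚ)) *
        qpow ((((L : ℤ) + 1 : ℤ) : ℚ) - ((K - (k * p' + a) : ℤ) : ℚ)) = qpow (L + 1 - K) *
        qpow ((((k * p + (r + 1)) * (k * p' + a) : ℤ) : ℚ)) := by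
      rw [← qpow_add, ← qpow_add]; push_cast; ring_nf
    rw [gaussian_pascal' (A := (L : ℤ) + 1) (B := K - k * p') (by omega),
      gaussian_pascal' (A := (L : ℤ) + 1) (B := K - (k * p' + a)) (by omega), add_sub_cancel_right,
      show K - k * p' - 1 = K - 1 - k * p' by ring,
      show K - (k * p' + a) - 1 = K - 1 - (k * p' + a) by ring]
    linear_combination gaussian L (K - 1 - k * p') * h1 - gaussian L (K - 1 - (k * p' + a)) * h2
  · exact bosonic_hasFiniteSupport p hp' a r L K
  · exact (bosonic_hasFiniteSupport p hp' a (r + 1) L (K - 1)).subset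
      fun k hk => right_ne_zero_of_mul hk

/-- Here the final height b = L + a - 2K is 0, and the reflection k ↦ -k with Gaussian symmetry
matches the two sums. At b = p' and r = p the reflection is k ↦ -1 - k. -/
theorem bosonic_lower_boundary (p : ℤ) {p' : ℤ} (hp' : 0 < p') {a L K : ℤ} (h : L + a = 2 * K) :
    bosonic p p' a 0 L K = 0 := by
  rw [bosonic_eq_sub p hp', sub_eq_zero, ← finsum_comp_equiv (Equiv.neg ℤ)]
  refine finsum_congr fun k => ?_
  rw [Equiv.neg_apply, ← gaussian_symm L (K - (k * p' + a)),
    show L - (K - (k * p' + a)) = K - -k * p' by linarith]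
  congr 3
  ring

theorem bosonic_upper_boundary (p : ℤ) {p' : ℤ} (hp' : 0 < p') {a L K : ℤ}
    (h : L + a - 2 * K = p') : bosonic p p' a p L K = 0 := by
  rw [bosonic_eq_sub p hp', sub_eq_zero, ← finsum_comp_equiv ((Equiv.subLeft (-1 : ℤ)))]
  refine finsum_congr fun k => ?_
  rw [Equiv.subLeft_apply, ← gaussian_symm L (K - (k * p' + a)),
    show L - (K - (k * p' + a)) = K - (-1 - k) * p' by linarith]
  congr 3
  ring

theorem bosonic_zero (p : ℤ) {p' a b : ℤ} (r : ℤ) (ha : 0 < a) (hap : a < p') (hb : 0 < b)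
    (hbp : b < p') {K : ℤ} (hK : a - b = 2 * K) :
    bosonic p p' a r 0 K = if a = b then 1 else 0 := by
  have h2 : ∀ k, K - (k * p' + a) ≠ 0 := by
    intro k hk
    have : a + b = 2 * (-k) * p' := by linarith
    rcases le_or_gt (-k) 0 with h | h <;> nlinarith
  have h1 : ∀ k, k ≠ 0 → K - k * p' ≠ 0 := by
    intro k hk hk'
    have : a - b = 2 * k * p' := by linarith
    rcases lt_or_gt_of_ne hk with h | h <;> nlinarith
  rw [bosonic, finsum_eq_single _ 0]
  · have h3 : K - a ≠ 0 := by simpa using h2 0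
    simp only [gaussian_zero_left, zero_mul, sub_zero, zero_add, if_neg h3, mul_zero]
    rw [if_congr (show K = 0 ↔ a = b by omega) rfl rfl]
    simp [qpow_zero]
  · intro k hk
    simp [gaussian_zero_left, h1 k hk, h2 k]

/-! ### Recurrences for path generating functions and finitised characters. -/

theorem mem_paths {p' : ℕ} {a b : ℤ} {L : ℕ} {h : Fin (L + 1) → ℤ} :
    h ∈ paths p' a b L ↔ (∀ i, 1 ≤ h i ∧ h i ≤ (p' : ℤ) - 1) ∧ h 0 = a ∧ h (Fin.last L) = b ∧
      ∀ i : Fin L, h i.succ = h i.castSucc + 1 ∨ h i.succ = h i.castSucc - 1 := by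
  simp [paths, Fintype.mem_piFinset]

theorem phi_eq_zero (p p' : ℕ) (a c : ℤ) (L : ℕ) {b : ℤ} (hb : ¬(1 ≤ b ∧ b ≤ (p' : ℤ) - 1)) :
    phi p p' a b c L = 0 := by
  rw [phi, Finset.sum_eq_zero]
  intro h hh
  obtain ⟨h1, -, h2, -⟩ := mem_paths.mp hh
  exact absurd (h2 ▸ h1 (Fin.last L)) hb

theorem phi_zero (p p' : ℕ) (a b c : ℤ) (ha : 1 ≤ a ∧ a ≤ (p' : ℤ) - 1) :
    phi p p' a b c 0 = if a = b then 1 else 0 := by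
  have hw : ∀ h : Fin 1 → ℤ, weight p p' c h = 0 := fun h => by simp [weight]
  split_ifs with hab
  · have : paths p' a b 0 = {fun _ => a} := by
      ext h
      rw [mem_paths, Finset.mem_singleton]
      constructor
      · rintro ⟨-, h0, -, -⟩
        funext i
        rw [Fin.fin_one_eq_zero i, ← h0]
      · rintro rfl
        exact ⟨fun _ => ha, rfl, hab, fun i => i.elim0⟩
    simp [phi, this, hw, qpow_zero]
  · rw [phi, Finset.sum_eq_zero]
    intro h hh
    obtain ⟨-, h0, h2, -⟩ := mem_paths.mp hh
    exact absurd (h0.symm.trans h2) hab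

theorem height_init {L : ℕ} (h : Fin (L + 2) → ℤ) (c : ℤ) {i : ℕ} (hi : i ≤ L + 1) :
    height (Fin.init h : Fin (L + 1) → ℤ) (h (Fin.last (L + 1))) i = height h c i := by
  unfold height
  rw [dif_pos (show i < L + 1 + 1 by omega)]
  split_ifs with hi'
  · rfl
  · exact congrArg h (Fin.ext (by simp; omega))

/-- The deleted endpoint serves as the extra height of the shortened path, so all other local
weights are unchanged. -/
theorem weight_init (p p' : ℕ) {L : ℕ} (h : Fin (L + 2) → ℤ) (c : ℤ) :
    weight p p' c h = weight p p' (h (Fin.last (L + 1))) (Fin.init h : Fin (L + 1) → ℤ) +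
      ((L : ℚ) + 1) * localWeight p p' (h (Fin.last L).castSucc) (h (Fin.last (L + 1))) c := by
  rw [weight, Finset.sum_Icc_succ_top (by omega), weight]
  congr 1
  · refine Finset.sum_congr rfl fun i hi => ?_
    have := Finset.mem_Icc.mp hi
    rw [height_init h c (by omega), height_init h c (by omega), height_init h c (by omega)]
  · have e1 : height h c (L + 1 - 1) = h (Fin.last L).castSucc := by
      rw [height, dif_pos (by omega)]; rfl
    have e2 : height h c (L + 1) = h (Fin.last (L + 1)) := by
      rw [height, dif_pos (by omega)]; rfl
    have e3 : height h c (L + 1 + 1) = c := by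
      rw [height, dif_neg (by omega)]
    rw [e1, e2, e3]
    push_cast; rfl

theorem sum_paths_of_penultimate (p p' : ℕ) (a b c e : ℤ) (L : ℕ) (he : b = e + 1 ∨ b = e - 1)
    (hb : 1 ≤ b ∧ b ≤ (p' : ℤ) - 1) :
    ∑ h ∈ (paths p' a b (L + 1)).filter (fun h => h (Fin.last L).castSucc = e),
      qpow (weight p p' c h) = qpow (((L : ℚ) + 1) * localWeight p p' e b c) *
        phi p p' a e b L := by
  rw [phi, Finset.mul_sum]
  refine Finset.sum_bij' (fun h _ => (Fin.init h : Fin (L + 1) → ℤ))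
    (fun h _ => (Fin.snoc h b : Fin (L + 2) → ℤ)) ?_ ?_ ?_ ?_ ?_
  · intro h hh
    obtain ⟨hh, hhe⟩ := Finset.mem_filter.mp hh
    obtain ⟨h1, h2, h3, h4⟩ := mem_paths.mp hh
    exact mem_paths.mpr ⟨fun i => h1 _, h2, hhe, fun i => h4 i.castSucc⟩
  · intro h hh
    obtain ⟨h1, h2, h3, h4⟩ := mem_paths.mp hh
    refine Finset.mem_filter.mpr ⟨mem_paths.mpr ⟨fun i => ?_, ?_, by simp, fun i => ?_⟩, by simpa⟩
    · refine Fin.lastCases ?_ (fun i => ?_) i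
      · simpa using hb
      · simpa using h1 i
    · rw [← Fin.castSucc_zero, Fin.snoc_castSucc, h2]
    · refine Fin.lastCases ?_ (fun i => ?_) i
      · simpa [h3] using he
      · rw [← Fin.castSucc_succ, Fin.snoc_castSucc, Fin.snoc_castSucc]
        exact h4 i
  · intro h hh
    obtain ⟨hh, -⟩ := Finset.mem_filter.mp hh
    obtain ⟨-, -, h3, -⟩ := mem_paths.mp hh
    rw [← h3, Fin.snoc_init_self]
  · intro h _
    simp
  · intro h hh
    obtain ⟨hh, hhe⟩ := Finset.mem_filter.mp hh
    obtain ⟨-, -, h3, -⟩ := mem_paths.mp hh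
    rw [weight_init, h3, hhe, qpow_add, mul_comm]

theorem phi_succ (p p' : ℕ) (a b c : ℤ) (L : ℕ) (hb : 1 ≤ b ∧ b ≤ (p' : ℤ) - 1) :
    phi p p' a b c (L + 1) =
      qpow (((L : ℚ) + 1) * localWeight p p' (b - 1) b c) * phi p p' a (b - 1) b L +
      qpow (((L : ℚ) + 1) * localWeight p p' (b + 1) b c) * phi p p' a (b + 1) b L := by
  rw [← sum_paths_of_penultimate p p' a b c (b - 1) L (by omega) hb,
    ← sum_paths_of_penultimate p p' a b c (b + 1) L (by omega) hb, phi,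
    ← Finset.sum_filter_add_sum_filter_not _ (fun h => h (Fin.last L).castSucc = b - 1)]
  congr 1
  refine Finset.sum_congr (Finset.filter_congr fun h hh => ?_) fun _ _ => rfl
  obtain ⟨-, -, h3, h4⟩ := mem_paths.mp hh
  have := h4 (Fin.last L)
  rw [Fin.succ_last, h3] at this
  omega

/-- The exponent of the normalising factor of `chi`. -/
def normExp (p p' : ℕ) (a b c : ℤ) (L : ℕ) : ℚ :=
  -(rHat p p' c : ℚ) * ((a : ℚ) - b + ((c : ℚ) - b) * L) / 2
      - ((a : ℚ) - b) * ((a : ℚ) - c) / 4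

theorem chi_eq (p p' : ℕ) (a b c : ℤ) (L : ℕ) :
    chi p p' a b c L = qpow (normExp p p' a b c L) * phi p p' a b c L := rfl

/-- The normalisation leaves coefficients that involve `rHat` only through a difference of
neighbouring values. Since that difference is 0 or 1 at interior heights, one coefficient is 1 and
the other a Pascal power. -/
theorem chi_succ_up (p p' : ℕ) (a b : ℤ) (L : ℕ) (hb : 1 ≤ b ∧ b ≤ (p' : ℤ) - 1) :
    chi p p' a b (b + 1) (L + 1) =
      qpow ((1 - ((rHat p p' (b + 1) : ℚ) - rHat p p' b)) * (L + 1 + a - b) / 2) *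
        chi p p' a (b - 1) b L +
      qpow (((rHat p p' (b + 1) : ℚ) - rHat p p' b) * (L + 1 - a + b) / 2) *
        chi p p' a (b + 1) b L := by
  have e1 : localWeight p p' (b - 1) b (b + 1) = 1 / 2 := if_neg (by omega)
  have e2 : localWeight p p' (b + 1) b (b + 1) = rHat p p' (b + 1) := by
    rw [localWeight, if_pos rfl, if_neg (by omega)]
  rw [chi_eq, chi_eq, chi_eq, phi_succ p p' a b _ L hb, e1, e2, mul_add, ← mul_assoc, ← mul_assoc,
    ← mul_assoc, ← mul_assoc, ← qpow_add, ← qpow_add, ← qpow_add, ← qpow_add]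
  unfold normExp
  congr 3
  · push_cast; ring
  · push_cast; ring

theorem chi_succ_down (p p' : ℕ) (a b : ℤ) (L : ℕ) (hb : 1 ≤ b ∧ b ≤ (p' : ℤ) - 1) :
    chi p p' a b (b - 1) (L + 1) =
      qpow (((rHat p p' b : ℚ) - rHat p p' (b - 1)) * (L + 1 + a - b) / 2) *
        chi p p' a (b - 1) b L +
      qpow ((1 - ((rHat p p' b : ℚ) - rHat p p' (b - 1))) * (L + 1 - a + b) / 2) *
        chi p p' a (b + 1) b L := by
  have e1 : localWeight p p' (b + 1) b (b - 1) = 1 / 2 := if_neg (by omega)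
  have e2 : localWeight p p' (b - 1) b (b - 1) = -rHat p p' (b - 1) := by
    rw [localWeight, if_pos rfl, if_pos (by omega)]
  rw [chi_eq, chi_eq, chi_eq, phi_succ p p' a b _ L hb, e1, e2, mul_add, ← mul_assoc, ← mul_assoc,
    ← mul_assoc, ← mul_assoc, ← qpow_add, ← qpow_add, ← qpow_add, ← qpow_add]
  unfold normExp
  congr 3
  · push_cast; ring
  · push_cast; ring

theorem chi_zero (p p' : ℕ) (a b c : ℤ) (ha : 1 ≤ a ∧ a ≤ (p' : ℤ) - 1) :
    chi p p' a b c 0 = if a = b then 1 else 0 := by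
  rw [chi, phi_zero p p' a b c ha]
  split_ifs with hab
  · simp [hab, qpow_zero]
  · simp

theorem chi_eq_zero (p p' : ℕ) (a c : ℤ) (L : ℕ) {b : ℤ} (hb : ¬(1 ≤ b ∧ b ≤ (p' : ℤ) - 1)) :
    chi p p' a b c L = 0 := by
  rw [chi, phi_eq_zero p p' a c L hb, mul_zero]

/-! ### Finitised characters as bosonic polynomials. -/

/-- The floor of h - hp/p' drops a full unit because, by coprimality, hp/p' is not an integer. -/
theorem rHat_eq {p p' : ℕ} (hcop : Nat.Coprime p p') {h : ℤ} (h1 : 1 ≤ h)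
    (h2 : h ≤ (p' : ℤ) - 1) : rHat p p' h = h - 1 - h * p / p' := by
  have hp' : (0 : ℤ) < p' := by omega
  have hr : rHat p p' h = (h * ((p' : ℤ) - p)) / p' := by
    rw [rHat, ← Rat.floor_intCast_div_natCast]
    push_cast; rfl
  have hne : ¬(p' : ℤ) ∣ h * p := fun hd => by
    have hd' := IsCoprime.dvd_of_dvd_mul_right (Nat.isCoprime_iff_coprime.mpr hcop.symm) hd
    have := Int.le_of_dvd (by omega) hd'
    omega
  have hm := Int.mul_ediv_add_emod (h * p) p'
  have hm1 := Int.emod_lt_of_pos (h * p) hp'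
  have hm2 := Int.emod_nonneg (h * p) hp'.ne'
  have hm3 : h * p % p' ≠ 0 := fun h0 => hne (Int.dvd_of_emod_eq_zero h0)
  rw [hr, Int.ediv_eq_iff_of_pos hp']
  constructor <;> nlinarith [lt_of_le_of_ne hm2 hm3.symm]

theorem ediv_succ {p p' : ℕ} (hpp' : p < p') (h : ℤ) :
    (h + 1) * p / p' = h * p / p' ∨ (h + 1) * p / p' = h * p / (p' : ℤ) + 1 := by
  have hp' : (0 : ℤ) < p' := by omega
  have hm := Int.mul_ediv_add_emod (h * p) p'
  have hm1 := Int.emod_lt_of_pos (h * p) hp'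
  have hm2 := Int.emod_nonneg (h * p) hp'.ne'
  rcases lt_or_ge (h * p % p' + p) (p' : ℤ) with hlt | hge
  · left
    rw [Int.ediv_eq_iff_of_pos hp']
    constructor <;> nlinarith
  · right
    rw [Int.ediv_eq_iff_of_pos hp']
    constructor <;> nlinarith

/-- `K` counts the down steps. With ρ = ⌊bp/p'⌋, the two shorter characters ending next to b have r
= ρ and r = ρ + 1. The new r is one of these, according to whether the floor jumps, and this selects
`bosonic_succ'` or `bosonic_succ`. -/
theorem chi_eq_bosonic {p p' : ℕ} (hpp' : p < p') (hcop : Nat.Coprime p p')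
    {a : ℤ} (ha : 1 ≤ a ∧ a ≤ (p' : ℤ) - 1) (L : ℕ) :
    ∀ b K : ℤ, 1 ≤ b → b ≤ (p' : ℤ) - 1 → L + a - b = 2 * K →
      (b + 1 ≤ (p' : ℤ) - 1 →
        chi p p' a b (b + 1) L = bosonic p p' a ((b + 1) * p / p') L K) ∧
      (1 ≤ b - 1 → chi p p' a b (b - 1) L = bosonic p p' a ((b - 1) * p / p' + 1) L K) := by
  have hp' : (0 : ℤ) < p' := by omega
  induction L with
  | zero =>
    intro b K hb1 hb2 hK
    have h0 : ∀ c r, chi p p' a b c 0 = bosonic p p' a r (0 : ℕ) K := fun c r => by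
      rw [chi_zero p p' a b c ha, Nat.cast_zero, bosonic_zero (b := b) _ _ (by omega) (by omega) (by omega)
        (by omega) (by simpa using hK)]
    exact ⟨fun _ => h0 _ _, fun _ => h0 _ _⟩
  | succ L ih =>
    intro b K hb1 hb2 hK
    push_cast at hK
    have hlow : chi p p' a (b - 1) b L = bosonic p p' a (b * p / p') L K := by
      by_cases hb : 1 ≤ b - 1
      · simpa using (ih (b - 1) K hb (by omega) (by omega)).1 (by omega)
      · obtain rfl : b = 1 := by omega
        rw [chi_eq_zero p p' a _ L (by omega),
          show (1 * p / p' : ℤ) = 0 from Int.ediv_eq_zero_of_lt (by omega) (by omega),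
          bosonic_lower_boundary _ hp' (by omega)]
    have hup : chi p p' a (b + 1) b L = bosonic p p' a (b * p / p' + 1) L (K - 1) := by
      by_cases hb : b + 1 ≤ (p' : ℤ) - 1
      · simpa using (ih (b + 1) (K - 1) (by omega) hb (by omega)).2 (by omega)
      · obtain rfl : b = p' - 1 := by omega
        -- Hence r = ρ + 1 = p at the upper wall, as the reflection argument requires.
        have hdiv : (((p' : ℤ) - 1) * p / p' : ℤ) = p - 1 := by
          have hp : 0 < p := Nat.pos_of_ne_zero fun h => by
            rw [h, Nat.coprime_zero_left] at hcop; omega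
          rw [Int.ediv_eq_iff_of_pos hp']
          constructor <;> nlinarith
        rw [chi_eq_zero p p' a _ L (by omega), hdiv, sub_add_cancel,
          bosonic_upper_boundary _ hp' (by omega)]
    have hKq : (L : ℚ) + 1 + a - b = 2 * K := by exact_mod_cast hK
    have e1 : ((L : ℚ) + 1 + a - b) / 2 = K := by rw [hKq]; ring
    have e2 : ((L : ℚ) + 1 - a + b) / 2 = L + 1 - K := by linarith
    have hs1 := bosonic_succ p hp' a (b * p / p' + 1) L K
    have hs2 := bosonic_succ' p hp' a (b * p / p') L K
    rw [add_sub_cancel_right] at hs1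
    push_cast
    refine ⟨fun hb => ?_, fun hb => ?_⟩
    · rw [chi_succ_up p p' a b L ⟨hb1, hb2⟩, rHat_eq hcop hb1 hb2, rHat_eq hcop (by omega) hb,
        hlow, hup, mul_div_assoc, mul_div_assoc, e1, e2]
      rcases ediv_succ hpp' b with h | h
      · rw [h, hs2]; push_cast; ring_nf; rw [qpow_zero]; ring
      · rw [h, hs1]; push_cast; ring_nf; rw [qpow_zero]; ring
    · rw [chi_succ_down p p' a b L ⟨hb1, hb2⟩, rHat_eq hcop hb1 hb2, rHat_eq hcop hb (by omega),
        hlow, hup, mul_div_assoc, mul_div_assoc, e1, e2]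
      rcases ediv_succ hpp' (b - 1) with h | h
      · rw [sub_add_cancel] at h
        rw [← h, hs1]; push_cast; ring_nf; rw [qpow_zero]; ring
      · rw [sub_add_cancel] at h
        rw [← h, hs2, h]; push_cast; ring_nf; rw [qpow_zero]; ring

/-- Comparison with (r₀ - p, s₀ - p') gives s₀ < p'. Then (p - r₀, p' - s₀) is also a solution, and
minimality against it gives the half bounds. -/
theorem IsMinimalSolution.halfSolution {p p' r₀ s₀ : ℕ} (hp : 0 < p) (hp' : 2 < p')
    (h : IsMinimalSolution p p' r₀ s₀) : HalfSolution p p' r₀ s₀ := by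
  obtain ⟨h1, hmin⟩ := h
  have hd : (p : ℤ) * s₀ - p' * r₀ = 1 ∨ (p : ℤ) * s₀ - p' * r₀ = -1 := by
    rcases abs_choice ((p : ℤ) * s₀ - p' * r₀) with h | h <;> omega
  have hlt : s₀ < p' := by
    by_contra hge
    have hge' : (p' : ℤ) ≤ s₀ := by omega
    have hr : (p : ℤ) ≤ r₀ := by
      by_contra hr
      rcases hd with hd | hd <;> nlinarith
    have := (hmin (r₀ - p) (s₀ - p') (by
      rw [← h1]
      congr 1
      push_cast [Nat.cast_sub (show p ≤ r₀ by omega), Nat.cast_sub (show p' ≤ s₀ by omega)]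
      ring)).2
    omega
  have hrp : r₀ ≤ p := by
    by_contra hr
    have hr' : (p : ℤ) + 1 ≤ r₀ := by omega
    have hlt' : (s₀ : ℤ) + 1 ≤ p' := by omega
    rcases hd with hd | hd <;> nlinarith
  have := hmin (p - r₀) (p' - s₀) (by
    rw [← h1, ← abs_neg]
    congr 1
    push_cast [Nat.cast_sub hrp, Nat.cast_sub hlt.le]
    ring)
  exact ⟨by omega, by omega, by omega, by omega, by omega, by omega, hd⟩

theorem chi_minimal_eq_bosonic {p p' : ℕ} (hp : 0 < p) (hpp' : p < p') (hp' : 2 < p')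
    (hcop : Nat.Coprime p p') {r s : ℕ} (h : HalfSolution p p' r s) (N : ℕ) :
    chi p p' s s (s + 1) (2 * N) = bosonic p p' s r (2 * N) N := by
  have hs2 := h.s_le
  have hd := h.det
  have hs : 1 ≤ (s : ℤ) := by
    by_contra hs
    obtain rfl : s = 0 := by omega
    have hr0 : r ≠ 0 := by rintro rfl; simp at hd
    have : (1 : ℤ) ≤ r := by omega
    rcases hd with hd | hd <;> push_cast at hd <;> nlinarith
  have hdiv : (((s : ℤ) + 1) * p / p' : ℤ) = r := by
    rw [Int.ediv_eq_iff_of_pos (by omega)]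
    rcases hd with hd | hd
    · have hne : (p : ℤ) + 1 ≠ p' := by
        intro hne
        have hdvd : (p' : ℤ) ∣ s + 1 := ⟨s - r, by rw [← hne] at hd ⊢; linarith⟩
        have := Int.le_of_dvd (by omega) hdvd
        omega
      constructor <;> nlinarith [show (p : ℤ) + 1 < p' by omega]
    · constructor <;> nlinarith
  have := ((chi_eq_bosonic hpp' hcop (a := s) ⟨hs, by omega⟩ (2 * N)) s N hs (by omega)
    (by push_cast; ring)).1 (by omega)
  rw [this, hdiv]
  push_cast; rfl

/-! ### The Cartan matrix and the sum over vectors m. -/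

theorem validCF_of_one_le : ∀ {c : List ℕ} (h : c ≠ []), (∀ x ∈ c, 1 ≤ x) → 2 ≤ c.getLast h →
    ValidCF c
  | [_], _, _, h2 => h2
  | _ :: b :: l, _, h1, h2 =>
    ⟨h1 _ List.mem_cons_self, validCF_of_one_le (List.cons_ne_nil b l)
      (fun x hx => h1 x (List.mem_cons_of_mem _ hx)) (by simpa using h2)⟩

theorem IsContFrac.validCF {c : List ℕ} {x : ℚ} (h : IsContFrac c x) (hx : 1 < x) :
    ValidCF c := by
  obtain ⟨hne, h1, h2, hv⟩ := h
  match c, hne, h1, h2, hv with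
  | [a], _, _, h2, _ => exact h2
  | a :: b :: l, _, h1, h2, hv =>
    have htail : ValidCF (b :: l) := by
      refine validCF_of_one_le (List.cons_ne_nil b l) (fun x hx => ?_) (by simpa using h2)
      obtain ⟨i, hi, rfl⟩ := List.getElem_of_mem hx
      exact h1 (i + 1) (by simpa using hi) (by omega)
    refine ⟨Nat.one_le_iff_ne_zero.mpr fun ha => ?_, htail⟩
    have hone := htail.one_lt_cfValue
    have : 1 / cfValue (b :: l) < 1 := by rw [div_lt_one (by linarith)]; exact hone
    rw [cfValue, ha] at hv
    push_cast at hv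
    linarith

theorem length_rows_add_two : ∀ {c : List ℕ}, ValidCF c → (rows c).length + 2 = c.sum
  | [a], h => by
    have : 2 ≤ a := h
    simp only [rows, List.length_replicate, List.sum_singleton]
    omega
  | a :: b :: l, h => by
    have ih := length_rows_add_two h.2
    have := h.1
    rw [List.sum_cons, ← ih]
    simp only [rows, List.length_append, List.length_replicate, List.length_cons]
    omega

theorem length_rows {c : List ℕ} (h : ValidCF c) : (rows c).length = rank c := by
  have := length_rows_add_two h
  rw [rank, zoneEnd, if_pos rfl, List.take_length]
  omega

theorem zoneEnd_cons_succ (a : ℕ) (c : List ℕ) (μ : ℕ) :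
    zoneEnd (a :: c) (μ + 1) = a + zoneEnd c μ := by
  simp only [zoneEnd, List.length_cons, Nat.add_right_cancel_iff, List.take_succ_cons,
    List.sum_cons]
  push_cast
  ring

theorem isZoneEnd_cons_cons {a b : ℕ} {l : List ℕ} (hb : 1 ≤ b) (j : ℕ) :
    IsZoneEnd (a :: b :: l) j ↔ j + 1 = a ∨ a ≤ j ∧ IsZoneEnd (b :: l) (j - a) := by
  have h1 : zoneEnd (a :: b :: l) 1 = a - 1 := by
    rw [zoneEnd, if_neg (by simp)]
    simp; ring
  constructor
  · rintro ⟨μ, hμ1, hμ2, hj⟩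
    obtain ⟨ν, rfl⟩ : ∃ ν, μ = ν + 1 := ⟨μ - 1, by omega⟩
    rcases Nat.eq_zero_or_pos ν with rfl | hν
    · left
      rw [zero_add, h1] at hj
      omega
    · right
      have hν2 : ν < (b :: l).length := by simpa using hμ2
      obtain ⟨ρ, rfl⟩ : ∃ ρ, ν = ρ + 1 := ⟨ν - 1, by omega⟩
      have hz : 0 ≤ zoneEnd (b :: l) (ρ + 1) := by
        rw [zoneEnd, if_neg hν2.ne, List.take_succ_cons, List.sum_cons,
          Nat.cast_add]
        omega
      rw [zoneEnd_cons_succ] at hj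
      exact ⟨by omega, ρ + 1, hν, hν2, by omega⟩
  · rintro (h | ⟨h, μ, hμ1, hμ2, hj⟩)
    · exact ⟨1, le_rfl, by simp, by rw [h1]; omega⟩
    · refine ⟨μ + 1, by omega, by simpa using hμ2, ?_⟩
      rw [zoneEnd_cons_succ]
      omega

theorem ValidCF.one_le_head {b : ℕ} {l : List ℕ} (h : ValidCF (b :: l)) : 1 ≤ b := by
  cases l
  · exact le_trans one_le_two h
  · exact h.1

theorem isZoneEnd_iff : ∀ {c : List ℕ}, ValidCF c → ∀ j : ℕ,
    IsZoneEnd c j ↔ (rows c).getD j false = true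
  | [a], _, j => by
    constructor
    · rintro ⟨μ, h1, h2, -⟩
      simp at h2
      omega
    · intro h
      rw [rows, List.getD_eq_getElem?_getD, List.getElem?_replicate] at h
      split_ifs at h <;> simp at h
  | a :: b :: l, h, j => by
    have ih := isZoneEnd_iff h.2
    rw [isZoneEnd_cons_cons h.2.one_le_head, ih, rows]
    have ha := h.1
    rcases lt_trichotomy (j + 1) a with hj | hj | hj
    · have hrep : (List.replicate (a - 1) false).getD j false = false := by
        rw [List.getD_eq_getElem?_getD, List.getElem?_replicate]
        split_ifs <;> rfl
      rw [List.getD_append _ _ _ _ (by simp; omega), hrep]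
      simp only [Bool.false_eq_true, iff_false]
      omega
    · rw [List.getD_append_right _ _ _ _ (by simp; omega)]
      simp [hj, show j - (a - 1) = 0 by omega]
    · rw [List.getD_append_right _ _ _ _ (by simp; omega), List.length_replicate,
        show j - (a - 1) = j - a + 1 by omega, List.getD_cons_succ]
      constructor
      · rintro (h | h)
        · omega
        · exact h.2
      · exact fun h => Or.inr ⟨by omega, h⟩

-- The sequence τ is m shifted by one and padded with zeros at both ends, so that matrix entries
-- dropped at the boundary need no separate treatment.
open Classical in
theorem cartan_mulVec {c : List ℕ} (hc : ValidCF c) {m : Fin (rank c) → ℤ} {τ : ℕ → ℤ}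
    (h0 : τ 0 = 0) (hm : ∀ j : Fin (rank c), m j = τ (j + 1))
    (hτ : ∀ j, rank c ≤ j → τ (j + 1) = 0) (j : Fin (rank c)) :
    (cartan c *ᵥ m) j = if (rows c).getD j false = true then τ (j + 1) + τ (j + 2) - τ j
      else 2 * τ (j + 1) - τ (j + 2) - τ j := by
  have hsum : (cartan c *ᵥ m) j = ∑ k ∈ Finset.range (rank c),
      ((if k + 1 = j then -τ (k + 1) else 0) +
        ((if k = j then (if IsZoneEnd c j then 1 else 2) * τ (k + 1) else 0) +
        (if k = j + 1 then (if IsZoneEnd c j then 1 else -1) * τ (k + 1) else 0))) := by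
    rw [Matrix.mulVec, dotProduct, ← Fin.sum_univ_eq_sum_range (fun k =>
      ((if k + 1 = j then -τ (k + 1) else 0) +
        ((if k = j then (if IsZoneEnd c j then 1 else 2) * τ (k + 1) else 0) +
        (if k = j + 1 then (if IsZoneEnd c j then 1 else -1) * τ (k + 1) else 0))))]
    refine Finset.sum_congr rfl fun k _ => ?_
    rw [cartan, Matrix.of_apply, hm]
    simp only [Fin.ext_iff]
    by_cases h1 : (k : ℕ) + 1 = j
    · simp [h1, show ¬(k : ℕ) = j by omega, show ¬(k : ℕ) = j + 1 by omega]
    by_cases h2 : (k : ℕ) = j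
    · simp [h2]
    by_cases h3 : (k : ℕ) = j + 1
    · simp [h3, show ¬(j : ℕ) + 1 + 1 = j by omega]
    · simp [h1, h2, h3]
  have e1 : ∑ k ∈ Finset.range (rank c), (if k + 1 = (j : ℕ) then -τ (k + 1) else 0) = -τ j := by
    obtain ⟨j, hj⟩ := j
    rcases j with _ | j
    · simp [h0]
    · simp only [Nat.add_right_cancel_iff]
      rw [Finset.sum_ite_eq', if_pos (Finset.mem_range.mpr (by omega))]
  have e3 : ∑ k ∈ Finset.range (rank c),
      (if k = (j : ℕ) + 1 then (if IsZoneEnd c j then 1 else -1) * τ (k + 1) else 0) =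
      (if IsZoneEnd c j then 1 else -1) * τ (j + 2) := by
    rw [Finset.sum_ite_eq']
    split_ifs with h1 h2 h2
    · rfl
    · rfl
    all_goals rw [hτ (j + 1) (by simpa using h1)]; ring
  rw [hsum, Finset.sum_add_distrib, Finset.sum_add_distrib, e1, e3, Finset.sum_ite_eq',
    if_pos (Finset.mem_range.mpr j.2)]
  simp only [isZoneEnd_iff hc]
  split_ifs <;> ring

/-- The product of the row weights along a sequence; the entry after the last row must vanish. -/
def fermiTerm : List Bool → (ℕ → ℤ) → QField
  | [], κ => if κ 1 = 0 then 1 else 0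
  | b :: z, κ => rowWeight b (κ 0) (κ 1) (κ 2) * fermiTerm z fun i => κ (i + 1)

theorem fermiTerm_eq_prod (z : List Bool) (κ : ℕ → ℤ) :
    fermiTerm z κ = (∏ j ∈ Finset.range z.length,
      rowWeight (z.getD j false) (κ j) (κ (j + 1)) (κ (j + 2))) *
        if κ (z.length + 1) = 0 then 1 else 0 := by
  induction z generalizing κ with
  | nil => simp [fermiTerm]
  | cons b z ih =>
    rw [fermiTerm, ih, List.length_cons, Finset.prod_range_succ']
    simp only [List.getD_cons_zero, List.getD_cons_succ, zero_add]
    ring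

theorem rowExp_le {b : Bool} {A N k : ℤ} (h : rowWeight b A N k ≠ 0) :
    0 ≤ N ∧ N ≤ A - rowExp b N k := by
  have := gaussian_ne_zero_bounds (right_ne_zero_of_mul h)
  omega

theorem fermi_eq_zero (z : List Bool) {A N : ℕ} (h : A < N) : fermi z A N = 0 := by
  cases z with
  | nil => exact if_neg (by omega)
  | cons b z =>
    refine Finset.sum_eq_zero fun k hk => ?_
    have hk' := Finset.mem_range.mp hk
    by_contra hne
    have := rowExp_le (left_ne_zero_of_mul hne)
    cases b <;> simp [rowExp] at this <;> omega

/-- A nonzero row weight forces N ≤ A - e. Induction from the last row gives e ≥ 0, so the entries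
decrease along the rows; this makes the sum finite. -/
theorem fermiTerm_ne_zero_bounds {z : List Bool} : ∀ {κ : ℕ → ℤ}, (∀ i, 0 ≤ κ i) →
    fermiTerm z κ ≠ 0 → ∀ i ≤ z.length, κ (i + 1) ≤ κ 0 := by
  induction z with
  | nil =>
    intro κ hκ h i hi
    obtain rfl : i = 0 := by simpa using hi
    have : κ 1 = 0 := not_imp_comm.mp (fun h' => if_neg h') h
    simpa [this] using hκ 0
  | cons b z ih =>
    intro κ hκ h i hi
    have h1 := ih (fun i => hκ (i + 1)) (right_ne_zero_of_mul h)
    have h2 := rowExp_le (left_ne_zero_of_mul h)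
    have h3 := h1 0 (Nat.zero_le _)
    have h4 := hκ 2
    have h5 : κ 1 ≤ κ 0 := by
      cases b <;> simp [rowExp] at h2 h3 <;> omega
    rcases i with _ | i
    · exact h5
    · exact (h1 i (by simpa using hi)).trans h5

/-- The sequence `A, k 0, k 1, …`, continued by zero. -/
def extendSeq {l B : ℕ} (A : ℤ) (k : Fin l → Fin (B + 1)) : ℕ → ℤ
  | 0 => A
  | i + 1 => if h : i < l then ((k ⟨i, h⟩ : ℕ) : ℤ) else 0

theorem extendSeq_cons {l B : ℕ} (A : ℤ) (x : Fin (B + 1)) (k : Fin l → Fin (B + 1)) (i : ℕ) :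
    extendSeq A (Fin.cons x k : Fin (l + 1) → Fin (B + 1)) (i + 1) =
      extendSeq ((x : ℕ) : ℤ) k i := by
  rcases i with _ | i
  · simp [extendSeq]
  · simp only [extendSeq, Nat.add_lt_add_iff_right]
    split_ifs with h
    · exact congrArg (fun y : Fin (B + 1) => ((y : ℕ) : ℤ)) 
        (Fin.cons_succ (α := fun _ => Fin (B + 1)) x k ⟨i, h⟩)
    · rfl

/-- A fixed box {0, …, B} replaces the nested ranges of `fermi`. The arbitrary factor `H` on the
first entry absorbs the weight of the preceding row in the induction. -/
theorem sum_fermiTerm (B : ℕ) (z : List Bool) : ∀ {A : ℕ}, A ≤ B → ∀ H : ℤ → QField,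
    ∑ k : Fin z.length → Fin (B + 1), H (extendSeq A k 1) * fermiTerm z (extendSeq A k) =
      ∑ n ∈ Finset.range (B + 1), H n * fermi z A n := by
  induction z with
  | nil =>
    intro A _ H
    change ∑ k : Fin 0 → Fin (B + 1), H (extendSeq A k 1) * fermiTerm [] (extendSeq A k) = _
    simp [fermi, fermiTerm, extendSeq]
  | cons b z ih =>
    intro A hA H
    change ∑ k : Fin (z.length + 1) → Fin (B + 1),
      H (extendSeq A k 1) * fermiTerm (b :: z) (extendSeq A k) = _
    rw [← (Fin.consEquiv fun _ : Fin (z.length + 1) => Fin (B + 1)).sum_comp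
      (fun k : Fin (z.length + 1) → Fin (B + 1) =>
        H (extendSeq A k 1) * fermiTerm (b :: z) (extendSeq A k)),
      Fintype.sum_prod_type, ← Fin.sum_univ_eq_sum_range (fun n => H n * fermi (b :: z) A n)]
    refine Finset.sum_congr rfl fun x _ => ?_
    have hx : (x : ℕ) ≤ B := by omega
    have key := ih hx fun n => rowWeight b A (x : ℕ) n
    have hext : ∑ n ∈ Finset.range (B + 1), rowWeight b A (x : ℕ) n * fermi z x n =
        fermi (b :: z) A x := by
      refine (Finset.sum_subset (Finset.range_subset_range.mpr (by omega)) fun n _ hn => ?_).symm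
      rw [fermi_eq_zero z (by simpa using hn), mul_zero]
    rw [← hext, ← key, Finset.mul_sum]
    refine Finset.sum_congr rfl fun k _ => ?_
    have hc : ∀ i, extendSeq (A : ℤ) (Fin.consEquiv (fun _ : Fin (z.length + 1) => Fin (B + 1))
        (x, k)) (i + 1) = extendSeq ((x : ℕ) : ℤ) k i := extendSeq_cons _ _ _
    rw [fermiTerm, hc 0, hc 1, funext hc]
    rfl

/-- The quadratic form of the generalised Cartan matrix as a sum over rows. -/
theorem cartan_quadratic_form {c : List ℕ} (hc : ValidCF c)
    {m : Fin (rank c) → ℤ} {κ : ℕ → ℤ} (hm : ∀ j : Fin (rank c), m j = 2 * κ j)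
    (hκ : ∀ j, rank c ≤ j → κ j = 0) :
    m ⬝ᵥ cartan c *ᵥ m = 4 * (κ 0) ^ 2 + 4 * ∑ j ∈ Finset.range (rank c),
      rowExp ((rows c).getD j false) (κ j) (κ (j + 1)) ^ 2 := by
  set τ : ℕ → ℤ := fun i => i.casesOn 0 fun j => 2 * κ j with hτ
  have hC := cartan_mulVec hc (m := m) (τ := τ) rfl hm fun j hj => by simp [hτ, hκ j hj]
  -- Each m_j (Cm)_j is four times the row's square minus an increment of φ, for both kinds of row.
  -- Only φ(0) = 4 κ₀², which is L², survives the telescoping.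
  set φ : ℕ → ℤ := fun j => τ (j + 1) ^ 2 - τ j * τ (j + 1) with hφ
  have hrow : ∀ j : Fin (rank c), m j * (cartan c *ᵥ m) j =
      4 * rowExp ((rows c).getD j false) (κ j) (κ (j + 1)) ^ 2 - (φ (j + 1) - φ j) := by
    intro j
    rw [hC, hm]
    simp only [rowExp, hφ]
    have e1 : τ (j + 1) = 2 * κ j := rfl
    have e2 : τ (j + 2) = 2 * κ (j + 1) := rfl
    rw [e1, e2]
    split_ifs <;> ring
  rw [dotProduct, Finset.sum_congr rfl fun j _ => hrow j, Finset.sum_sub_distrib,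
    Fin.sum_univ_eq_sum_range (fun j => φ (j + 1) - φ j),
    Fin.sum_univ_eq_sum_range (fun j => 4 * rowExp ((rows c).getD j false) (κ j) (κ (j + 1)) ^ 2),
    Finset.sum_range_sub, ← Finset.mul_sum]
  have e0 : φ 0 = 4 * κ 0 ^ 2 := by simp [hφ, hτ]; ring
  have en : φ (rank c) = 0 := by simp [hφ, hτ, hκ _ le_rfl]
  rw [e0, en]
  ring

theorem qpow_sum {ι : Type*} (s : Finset ι) (f : ι → ℚ) :
    qpow (∑ i ∈ s, f i) = ∏ i ∈ s, qpow (f i) := by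
  classical
  induction s using Finset.induction_on with
  | empty => simp [qpow_zero]
  | insert i s hi ih => rw [Finset.sum_insert hi, Finset.prod_insert hi, qpow_add, ih]

/-- The term L²/4 cancels the first square of the quadratic form, and m_j - (Cm)_j / 2 becomes
κ_{j-1} + κ_j - e_j, with e_j the row exponent: the top of the row's Gaussian polynomial. -/
theorem summand_eq {c : List ℕ} (hc : ValidCF c) {b : Bool} {z : List Bool}
    (hcz : rows c = b :: z) {N : ℕ} {m : Fin (rank c) → ℤ} {κ : ℕ → ℤ}
    (hm : ∀ j : Fin (rank c), m j = 2 * κ j) (hκ : ∀ j, rank c ≤ j → κ j = 0) (h0 : κ 0 = N) :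
    summand c (2 * N) m = qpow ((rowExp b (κ 0) (κ 1) : ℚ) ^ 2) * fermiTerm z κ := by
  have hlen : rank c = z.length + 1 := by rw [← length_rows hc, hcz, List.length_cons]
  set g : ℕ → QField := fun j => gaussian (κ (j - 1) + κ j -
    rowExp ((rows c).getD j false) (κ j) (κ (j + 1))) (2 * κ j) with hg
  set τ : ℕ → ℤ := fun i => i.casesOn 0 fun j => 2 * κ j with hτ
  have hC := cartan_mulVec hc (m := m) (τ := τ) rfl hm fun j hj => by simp [hτ, hκ j hj]
  have hgauss : ∀ j : Fin (rank c), 0 < (j : ℕ) →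
      gaussian (m j - (cartan c *ᵥ m) j / 2) (m j) = g j := by
    intro j hj
    rw [hC, hm]
    obtain ⟨i, hi⟩ : ∃ i, (j : ℕ) = i + 1 := ⟨j - 1, by omega⟩
    rw [hi, hg]
    simp only [rowExp, hτ, Nat.add_sub_cancel]
    congr 1
    have he : κ (i + 2) = κ (i + 1 + 1) := rfl
    split_ifs <;> omega
  have hprod : ∏ j ∈ Finset.univ.filter (fun j : Fin (rank c) => 0 < (j : ℕ)),
      gaussian (m j - (cartan c *ᵥ m) j / 2) (m j) = ∏ j ∈ Finset.range z.length, g (j + 1) := by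
    rw [Finset.prod_congr rfl fun j hj => hgauss j (Finset.mem_filter.mp hj).2,
      Finset.prod_filter, Fin.prod_univ_eq_prod_range (fun j => if 0 < j then g j else 1), hlen,
      Finset.prod_range_succ']
    simp
  have hexp : ((m ⬝ᵥ cartan c *ᵥ m : ℤ) : ℚ) / 4 - ((2 * N : ℕ) : ℚ) ^ 2 / 4 =
      ∑ j ∈ Finset.range (rank c),
        (rowExp ((rows c).getD j false) (κ j) (κ (j + 1)) : ℚ) ^ 2 := by
    rw [cartan_quadratic_form hc hm hκ, h0]
    push_cast
    ring
  rw [summand, hprod, hexp, hlen, Finset.sum_range_succ', qpow_add, qpow_sum, fermiTerm_eq_prod,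
    if_pos (hκ _ hlen.le), mul_one]
  simp only [rowWeight, Finset.prod_mul_distrib, hg, hcz, List.getD_cons_succ, List.getD_cons_zero,
    Nat.add_sub_cancel, zero_add]
  ring

/-- The vector `m` with `m_0 = 2 N` and with `m_j / 2` given by `k`. -/
def vectorOf (c : List ℕ) (N : ℕ) {l : ℕ} (k : Fin l → Fin (N + 1)) : Fin (rank c) → ℤ :=
  fun j => 2 * extendSeq (N : ℤ) k j

theorem extendSeq_eq_zero {l B : ℕ} (A : ℤ) (k : Fin l → Fin (B + 1)) {j : ℕ} (hj : l + 1 ≤ j) :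
    extendSeq A k j = 0 := by
  obtain ⟨i, rfl⟩ : ∃ i, j = i + 1 := ⟨j - 1, by omega⟩
  exact dif_neg (by omega)

theorem extendSeq_nonneg {l B : ℕ} {A : ℤ} (hA : 0 ≤ A) (k : Fin l → Fin (B + 1)) (j : ℕ) :
    0 ≤ extendSeq A k j := by
  cases j with
  | zero => exact hA
  | succ i =>
    simp only [extendSeq]
    split_ifs <;> positivity

theorem vectorOf_injective {c : List ℕ} (N : ℕ) {l : ℕ} (h : rank c = l + 1) :
    Function.Injective (vectorOf c N : (Fin l → Fin (N + 1)) → _) := by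
  intro k k' hkk
  funext i
  have := congrFun hkk ⟨i + 1, by omega⟩
  simp only [vectorOf, extendSeq, i.2, dif_pos] at this
  exact Fin.ext (by simpa using this)

theorem vectorOf_mem {c : List ℕ} (N : ℕ) {l : ℕ} (k : Fin l → Fin (N + 1)) :
    vectorOf c N k ∈ mVectors c (2 * N) := by
  refine fun j => ⟨fun hj => ?_, fun _ => ⟨even_two_mul _, ?_⟩⟩
  · simp [vectorOf, hj, extendSeq]
  · have := extendSeq_nonneg (Int.natCast_nonneg N) k j
    simp only [vectorOf]
    omega

theorem mem_range_vectorOf {c : List ℕ} (hc : ValidCF c) {b : Bool} {z : List Bool}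
    (hcz : rows c = b :: z) (N : ℕ) {m : Fin (rank c) → ℤ} (hm : m ∈ mVectors c (2 * N))
    (hne : summand c (2 * N) m ≠ 0) :
    ∃ k : Fin z.length → Fin (N + 1), vectorOf c N k = m := by
  have hlen : rank c = z.length + 1 := by rw [← length_rows hc, hcz, List.length_cons]
  set κ : ℕ → ℤ := fun j => if h : j < rank c then m ⟨j, h⟩ / 2 else 0 with hκ
  have hκm : ∀ j : Fin (rank c), m j = 2 * κ j := by
    intro j
    rw [hκ]
    simp only [j.2, dif_pos, Fin.eta]
    rcases Nat.eq_zero_or_pos (j : ℕ) with hj | hj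
    · have := (hm j).1 hj
      push_cast at this
      omega
    · obtain ⟨x, hx⟩ := ((hm j).2 hj).1
      omega
  have h0 : κ 0 = N := by
    have := hκm ⟨0, by omega⟩
    rw [(hm ⟨0, by omega⟩).1 rfl] at this
    push_cast at this
    linarith
  have hnonneg : ∀ j, 0 ≤ κ j := by
    intro j
    rcases Nat.eq_zero_or_pos j with rfl | hj
    · omega
    · by_cases h : j < rank c
      · have h1 := hκm ⟨j, h⟩
        have h2 := ((hm ⟨j, h⟩).2 hj).2
        simp only at h1
        omega
      · simp [hκ, h]
  have hz : ∀ j, rank c ≤ j → κ j = 0 := fun j hj => dif_neg (by omega)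
  rw [summand_eq hc hcz hκm hz h0] at hne
  have hle := fermiTerm_ne_zero_bounds hnonneg (right_ne_zero_of_mul hne)
  refine ⟨fun i => ⟨(κ (i + 1)).toNat, ?_⟩, ?_⟩
  · have := hle i i.2.le
    omega
  · funext j
    rw [hκm j, vectorOf]
    congr 1
    obtain ⟨j, hj⟩ := j
    rcases j with _ | j
    · simpa [extendSeq] using h0.symm
    · simp only [extendSeq]
      rw [dif_pos (by omega)]
      exact Int.toNat_of_nonneg (hnonneg _)

theorem finsum_summand {c : List ℕ} (hc : ValidCF c) {b : Bool} {z : List Bool}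
    (hcz : rows c = b :: z) (N : ℕ) :
    {m : Fin (rank c) → ℤ | m ∈ mVectors c (2 * N) ∧ summand c (2 * N) m ≠ 0}.Finite ∧
      ∑ᶠ (m : Fin (rank c) → ℤ) (_ : m ∈ mVectors c (2 * N)), summand c (2 * N) m =
        ∑ k ∈ Finset.range (N + 1), qpow ((rowExp b N k : ℚ) ^ 2) * fermi z N k := by
  classical
  have hlen : rank c = z.length + 1 := by rw [← length_rows hc, hcz, List.length_cons]
  have hrange := fun m => @mem_range_vectorOf c hc b z hcz N m
  constructor
  · exact (Set.finite_range (vectorOf c N : (Fin z.length → Fin (N + 1)) → _)).subset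
      fun m hm => hrange m hm.1 hm.2
  · rw [finsum_mem_eq_sum_of_inter_support_eq (t := Finset.univ.image
      (vectorOf c N : (Fin z.length → Fin (N + 1)) → _)),
      Finset.sum_image (vectorOf_injective N hlen).injOn,
      ← sum_fermiTerm N z le_rfl fun n => qpow ((rowExp b N n : ℚ) ^ 2)]
    · refine Finset.sum_congr rfl fun k _ => ?_
      exact summand_eq hc hcz (fun j => rfl)
        (fun j hj => extendSeq_eq_zero _ _ (by omega)) rfl
    · ext m
      simp only [Set.mem_inter_iff, Function.mem_support, Finset.coe_image, Finset.coe_univ,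
        Set.image_univ, Set.mem_range]
      constructor
      · exact fun h => ⟨hrange m h.1 h.2, h.2⟩
      · rintro ⟨⟨k, rfl⟩, h⟩
        exact ⟨vectorOf_mem N k, h⟩

end FB

end

/-! ### The theorem. -/

theorem mainTheorem1 (p p' : ℕ) (hp : 0 < p) (hpp' : p < p') (hp' : 2 < p')
    (hcop : Nat.Coprime p p') (r₀ s₀ : ℕ) (hrs : FB.IsMinimalSolution p p' r₀ s₀)
    (c : List ℕ) (hc : FB.IsContFrac c ((p' : ℚ) / (p : ℚ)))
    (L : ℕ) (hL : Even L) :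
    {m : Fin (FB.rank c) → ℤ | m ∈ FB.mVectors c L ∧ FB.summand c L m ≠ 0}.Finite ∧
      FB.chi p p' (s₀ : ℤ) (s₀ : ℤ) ((s₀ : ℤ) + 1) L =
        ∑ᶠ (m : Fin (FB.rank c) → ℤ) (_ : m ∈ FB.mVectors c L), FB.summand c L m := by
  obtain ⟨N, rfl⟩ := hL.two_dvd
  have hpq : (0 : ℚ) < p := by exact_mod_cast hp
  have hvalid := hc.validCF ((one_lt_div hpq).mpr (by exact_mod_cast hpp'))
  have hval : ((p' : ℤ) : ℚ) = ((p : ℤ) : ℚ) * FB.cfValue c := by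
    rw [hc.value_eq]
    push_cast
    field_simp
  have hsol := hrs.halfSolution hp hp'
  -- No rows would mean p'/p = 2, hence p' = 2 by coprimality, which is excluded.
  obtain ⟨b, z, hbz⟩ : ∃ b z, FB.rows c = b :: z := by
    cases hr : FB.rows c with
    | cons b z => exact ⟨b, z, rfl⟩
    | nil =>
      rw [FB.rows_eq_nil hvalid hr] at hval
      have h2 : (p' : ℤ) = p * 2 := by
        simp only [FB.cfValue] at hval
        exact_mod_cast hval
      have hp1 : p = 1 :=
        Nat.eq_one_of_dvd_coprimes hcop dvd_rfl ⟨2, by exact_mod_cast h2⟩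
      omega
  obtain ⟨hfin, hsum⟩ := FB.finsum_summand hvalid hbz N
  refine ⟨hfin, ?_⟩
  rw [hsum, FB.chi_minimal_eq_bosonic hp hpp' hp' hcop hsol, FB.bosonic_eq_fermi hvalid hbz hsol hval]
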